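/- Let $k,N,n$ be positive integers. A set $B$ contains a $k$-term arithmetic progression (AP) with common difference $d$ if $a+d,a+2d,\dots,a+kd\in B$ for some $a$ in the ambient group; $d=0$ is allowed. For $E\subseteq\mathbb R^n$ let $N_E(\epsilon)$ be the smallest positive integer $m$ such that $E$ is covered by $m$ axis-parallel boxes of side lengths at most $\epsilon$ ($N_E(\epsilon)=\infty$ if there is none), and put \[\dim_M E=\limsup_{\epsilon\to0^+}\frac{\log N_E(\epsilon)}{\log(1/\epsilon)},\qquad \dim_P E=\inf\Big\{\sup_{j}\dim_M E_j : E\subseteq\bigcup_{j\in\mathbb N}E_j\Big\}.\] Let $f_n^M(k)$ and $f_n^P(k)$ be the infima of $\dim_M B$ and of $\dim_P B$, respectively, over all sets $B\subseteq\mathbb R^n$ that contain a $k$-term AP with every common difference $d\in[0,1]^n$. Let $F'_{n,k}(N)$ be the least cardinality of a set in $\mathbb R^n$ that contains a $k$-term AP with common difference $d$ for $N^n$ distinct values of $d\in\mathbb N^n$ (where $0\in\mathbb N$). Let $F'_k(N)$ be the least cardinality of a set of integers that contains a $k$-term AP with common difference $d$ for $N$ distinct values of $d\in\mathbb Z$,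 and $F_k(N)$ the least cardinality of a set of integers that contains a $k$-term AP with common difference $d$ for each $d\in\{1,\dots,N\}$. Theorem. (1) For all $n,k\ge1$ the limit $\lim_{N\to\infty}\log F'_{n,k}(N)/\log N$ exists, is finite, and \[f_n^P(k)=f_n^M(k)=\lim_{N\to\infty}\frac{\log F'_{n,k}(N)}{\log N}.\] (2) For all $k\ge1$ the limit $\lim_{N\to\infty}\log F'_{k}(N)/\log N$ exists, is finite, and \[f_1^P(k)=f_1^M(k)=\lim_{N\to\infty}\frac{\log F'_{k}(N)}{\log N}.\] (3) For every $n\ge1$ the following are equivalent (an iterated limit is understood to include the existence of the inner limit for every $k\ge1$): - (arithmetic Kakeya conjecture, first form) $\lim_{k\to\infty}\lim_{N\to\infty}\log F_k(N)/\log N=1$; - (arithmetic Kakeya conjecture, second form) $\lim_{k\to\infty}\lim_{N\to\infty}\log F'_k(N)/\log N=1$; - ($n$-dimensional arithmetic Kakeya conjecture) $\lim_{k\to\infty}\lim_{N\to\infty}\log F'_{n,k}(N)/\log N=n$; - ($n$-dimensional Minkowski arithmetic Kakeya conjecture) $\lim_{k\to\infty}f_n^M(k)=n$; - ($n$-dimensional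 packing arithmetic Kakeya conjecture) $\lim_{k\to\infty}f_n^P(k)=n$. Since the first two do not involve $n$, the last three conjectures, for all $n\ge1$ together, are all equivalent to each other. -/

import Mathlib

open Filter Topology

noncomputable section

/-- `B` contains the `k`-term arithmetic progression `a + d, a + 2d, …, a + kd` for some `a`. -/
def ContainsAP {M : Type*} [AddCommMonoid M] (B : Set M) (k : ℕ) (d : M) : Prop :=
  ∃ a : M, ∀ i : ℕ, 1 ≤ i → i ≤ k → a + i • d ∈ B

/-- `E ⊆ ℝⁿ` is covered by `m` axis-parallel closed boxes, all of whose side lengths are at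
most `ε`. -/
def CoveredByBoxes {n : ℕ} (E : Set (Fin n → ℝ)) (ε : ℝ) (m : ℕ) : Prop :=
  ∃ a b : Fin m → Fin n → ℝ,
    (∀ j i, a j i ≤ b j i ∧ b j i - a j i ≤ ε) ∧ E ⊆ ⋃ j, Set.Icc (a j) (b j)

/-- The smallest positive integer `m` such that `E` is covered by `m` boxes of side length at
most `ε`; it is `⊤` if there is no such `m`. -/
def boxNumber {n : ℕ} (E : Set (Fin n → ℝ)) (ε : ℝ) : ℕ∞ :=
  ⨅ (m : ℕ) (_ : 0 < m ∧ CoveredByBoxes E ε m), (m : ℕ∞)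

/-- (Upper) Minkowski dimension, i.e. upper box dimension. It is `⊤` for unbounded sets. -/
def minkowskiDim {n : ℕ} (E : Set (Fin n → ℝ)) : EReal :=
  limsup (fun ε : ℝ => ENNReal.log (boxNumber E ε : ENNReal) / ((Real.log (1 / ε) : ℝ) : EReal))
    (𝓝[>] 0)

/-- Packing dimension, i.e. modified upper box dimension. -/
def packingDim {n : ℕ} (E : Set (Fin n → ℝ)) : EReal :=
  ⨅ (S : ℕ → Set (Fin n → ℝ)) (_ : E ⊆ ⋃ j, S j), ⨆ j, minkowskiDim (S j)

/-- `B ⊆ ℝⁿ` contains a `k`-term arithmetic progression with every common difference in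
`[0,1]ⁿ`. -/
def ContainsAllAPs {n : ℕ} (B : Set (Fin n → ℝ)) (k : ℕ) : Prop :=
  ∀ d ∈ Set.Icc (0 : Fin n → ℝ) 1, ContainsAP B k d

/-- The infimum of the Minkowski dimensions of the subsets of `ℝⁿ` that contain a `k`-term
arithmetic progression with every common difference in `[0,1]ⁿ`. -/
def minkowskiAP (n k : ℕ) : EReal :=
  ⨅ (B : Set (Fin n → ℝ)) (_ : ContainsAllAPs B k), minkowskiDim B

/-- The infimum of the packing dimensions of the subsets of `ℝⁿ` that contain a `k`-term
arithmetic progression with every common difference in `[0,1]ⁿ`. -/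
def packingAP (n k : ℕ) : EReal :=
  ⨅ (B : Set (Fin n → ℝ)) (_ : ContainsAllAPs B k), packingDim B

/-- `F'_{n,k}(N)`: the least cardinality of a subset of `ℝⁿ` that contains a `k`-term arithmetic
progression with common difference `d` for `Nⁿ` distinct values of `d ∈ ℕⁿ`. -/
def minCardAPDim (n k N : ℕ) : ℕ :=
  sInf {c : ℕ | ∃ (A : Finset (Fin n → ℝ)) (D : Finset (Fin n → ℕ)),
    A.card = c ∧ D.card = N ^ n ∧
      ∀ d ∈ D, ContainsAP (A : Set (Fin n → ℝ)) k (fun i => (d i : ℝ))}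

/-- `F'_k(N)`: the least cardinality of a set of integers that contains a `k`-term arithmetic
progression with common difference `d` for `N` distinct values of `d ∈ ℤ`. -/
def minCardAPDistinct (k N : ℕ) : ℕ :=
  sInf {c : ℕ | ∃ A D : Finset ℤ,
    A.card = c ∧ D.card = N ∧ ∀ d ∈ D, ContainsAP (A : Set ℤ) k d}

/-- `F_k(N)`: the least cardinality of a set of integers that contains a `k`-term arithmetic
progression with common difference `d` for each `d ∈ {1, …, N}`. -/
def minCardAPInitial (k N : ℕ) : ℕ :=
  sInf {c : ℕ | ∃ A : Finset ℤ,
    A.card = c ∧ ∀ d ∈ Finset.Icc (1 : ℤ) N, ContainsAP (A : Set ℤ) k d}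

/-- `lim_{k → ∞} lim_{N → ∞} log F(k,N) / log N = a`, where the inner limit exists for every
`k ≥ 1`. -/
def IteratedExponentLimit (F : ℕ → ℕ → ℕ) (a : ℝ) : Prop :=
  ∃ L : ℕ → ℝ,
    (∀ k : ℕ, 1 ≤ k →
      Tendsto (fun N : ℕ => Real.log (F k N) / Real.log N) atTop (𝓝 (L k))) ∧
    Tendsto L atTop (𝓝 a)

/-- The arithmetic Kakeya conjecture, with every common difference in `{1, …, N}`. -/
def ArithmeticKakeyaInitial : Prop := IteratedExponentLimit minCardAPInitial 1

/-- The arithmetic Kakeya conjecture, with `N` distinct common differences. -/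
def ArithmeticKakeyaDistinct : Prop := IteratedExponentLimit minCardAPDistinct 1

/-- The `n`-dimensional arithmetic Kakeya conjecture. -/
def ArithmeticKakeyaDim (n : ℕ) : Prop := IteratedExponentLimit (minCardAPDim n) n

/-- The `n`-dimensional Minkowski arithmetic Kakeya conjecture. -/
def MinkowskiArithmeticKakeya (n : ℕ) : Prop :=
  Tendsto (fun k : ℕ => minkowskiAP n k) atTop (𝓝 (n : EReal))

/-- The `n`-dimensional packing arithmetic Kakeya conjecture. -/
def PackingArithmeticKakeya (n : ℕ) : Prop :=
  Tendsto (fun k : ℕ => packingAP n k) atTop (𝓝 (n : EReal))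

end

/-!
The sequence `F_k(N)` is submultiplicative (write a difference as `r + N q` and add a set for `r`
to a dilate of a set for `q`), so `log F_k(N) / log N` converges to some `α`. Everything else
reduces to this exponent.

Arbitrary `P` differences in a torsion-free group are no cheaper than `1, …, P`, up to `P ^ o(1)`.
A homomorphism to `ℚ` injective on the differences makes them integers. The map
`x ↦ ⌊P (t / q) x⌋ mod P`, for a random `t` modulo a large prime `q`, takes a positive proportion of
distinct values on them, while turning progressions into progressions up to a bounded set of
errors. Finally `O(log P)` translates of these values cover `ZMod P`.

For the upper bound on the dimensions, take a set `A ⊆ ℝⁿ` of at most `F_k(b) ^ n` points with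
progressions for all differences in `{0, …, b} ^ n`, and the fractal of all base-`b` expansions
with digits in `A`: progressions can be chosen digit by digit, and the dimension is at most
`log #A / log b`.

For the lower bound, let countably many pieces cover a set with all progressions. A progression is
finite, so the union of the first few pieces contains it, and by countable additivity one such
finite union serves a set of differences of positive outer measure. Rounding to the grid `N⁻¹ ℤⁿ`
gives at least `c N ^ n` differences in `ℤⁿ`, to which the previous comparison applies.
-/

/-! ### Growth exponents -/

/-- A positive monotone sequence with `F (N * M) ≤ F N * F M`, the setting of the multiplicative
form of Fekete's lemma. The value at `0` is unconstrained apart from monotonicity. -/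
structure IsSubmultiplicative (F : ℕ → ℝ) : Prop where
  monotone : Monotone F
  one_le : ∀ {N}, 1 ≤ N → 1 ≤ F N
  mul_le : ∀ {N M}, 1 ≤ N → 1 ≤ M → F (N * M) ≤ F N * F M

/-- The exponent `α` with `F N = N ^ (α + o(1))` when `F` is submultiplicative, defined as the
infimum of `log (F N) / log N` over the `N` with `log N ≠ 0`. -/
noncomputable def growthExponent (F : ℕ → ℝ) : ℝ :=
  sInf ((fun N : ℕ => Real.log (F N) / Real.log N) '' Set.Ici 2)

namespace IsSubmultiplicative

variable {F : ℕ → ℝ}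

theorem log_nonneg (hF : IsSubmultiplicative F) {N : ℕ} (hN : 1 ≤ N) : 0 ≤ Real.log (F N) :=
  Real.log_nonneg (hF.one_le hN)

theorem pow_le (hF : IsSubmultiplicative F) {M : ℕ} (hM : 1 ≤ M) (m : ℕ) :
    F (M ^ (m + 1)) ≤ F M ^ (m + 1) := by
  have hpos : 0 ≤ F M := zero_le_one.trans (hF.one_le hM)
  induction m with
  | zero => simp
  | succ m ih =>
    calc F (M ^ (m + 1 + 1)) ≤ F (M ^ (m + 1)) * F M :=
          hF.mul_le (Nat.one_le_pow _ _ hM) hM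
      _ ≤ F M ^ (m + 1 + 1) := mul_le_mul_of_nonneg_right ih hpos

theorem log_le (hF : IsSubmultiplicative F) {M N : ℕ} (hM : 2 ≤ M) (hN : 1 ≤ N) :
    Real.log (F N) ≤ Real.log (F M) / Real.log M * Real.log N + Real.log (F M) := by
  set m := Nat.log M N
  have hlogM : 0 < Real.log M := Real.log_pos (by exact_mod_cast hM)
  have hm : m * Real.log M ≤ Real.log N := by
    rw [← Real.log_pow]
    exact Real.log_le_log (by positivity) (by exact_mod_cast Nat.pow_log_le_self M (by omega))
  have hFN : F N ≤ F M ^ (m + 1) :=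
    (hF.monotone (Nat.lt_pow_succ_log_self hM N).le).trans (hF.pow_le (by omega) m)
  calc Real.log (F N) ≤ Real.log (F M ^ (m + 1)) :=
        Real.log_le_log (zero_lt_one.trans_le (hF.one_le hN)) hFN
    _ = Real.log (F M) / Real.log M * (m * Real.log M) + Real.log (F M) := by
        rw [Real.log_pow]
        push_cast
        field_simp
    _ ≤ _ := by
        gcongr
        exact div_nonneg (hF.log_nonneg (by omega)) hlogM.le

theorem growthExponent_le (hF : IsSubmultiplicative F) {N : ℕ} (hN : 2 ≤ N) :
    growthExponent F ≤ Real.log (F N) / Real.log N := by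
  refine csInf_le ⟨0, ?_⟩ (Set.mem_image_of_mem _ hN)
  rintro _ ⟨M, hM, rfl⟩
  exact div_nonneg (hF.log_nonneg (one_le_two.trans hM)) (Real.log_natCast_nonneg M)

theorem growthExponent_nonneg (hF : IsSubmultiplicative F) : 0 ≤ growthExponent F := by
  refine Real.sInf_nonneg ?_
  rintro _ ⟨N, hN, rfl⟩
  exact div_nonneg (hF.log_nonneg (one_le_two.trans hN)) (Real.log_natCast_nonneg N)

theorem rpow_growthExponent_le (hF : IsSubmultiplicative F) {N : ℕ} (hN : 1 ≤ N) :
    (N : ℝ) ^ growthExponent F ≤ F N := by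
  have hFN : 1 ≤ F N := hF.one_le hN
  rcases hN.eq_or_lt with rfl | hN2
  · simpa using hFN
  have hlogN : 0 < Real.log N := Real.log_pos (by exact_mod_cast hN2)
  rw [Real.rpow_le_iff_le_log (by positivity) (by linarith), ← le_div_iff₀ hlogN]
  exact hF.growthExponent_le hN2

theorem tendsto_log_div_log (hF : IsSubmultiplicative F) :
    Tendsto (fun N : ℕ => Real.log (F N) / Real.log N) atTop (𝓝 (growthExponent F)) := by
  refine tendsto_order.2 ⟨fun a ha => ?_, fun b hb => ?_⟩
  · filter_upwards [eventually_ge_atTop 2] with N hN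
    exact ha.trans_le (hF.growthExponent_le hN)
  obtain ⟨_, ⟨M, hM, rfl⟩, hMb⟩ := exists_lt_of_csInf_lt (Set.nonempty_Ici.image _) hb
  have hlog : Tendsto (fun N : ℕ => Real.log N) atTop atTop :=
    Real.tendsto_log_atTop.comp tendsto_natCast_atTop_atTop
  have hlim : Tendsto (fun N : ℕ => Real.log (F M) / Real.log M + Real.log (F M) / Real.log N)
      atTop (𝓝 (Real.log (F M) / Real.log M)) := by
    simpa using tendsto_const_nhds.add (hlog.const_div_atTop (Real.log (F M)))
  filter_upwards [hlim.eventually_lt_const hMb, eventually_ge_atTop 2] with N hNb hN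
  have hlogN : 0 < Real.log N := Real.log_pos (by exact_mod_cast hN)
  refine lt_of_le_of_lt ?_ hNb
  rw [div_le_iff₀ hlogN, add_mul, div_mul_cancel₀ _ hlogN.ne']
  exact hF.log_le hM (by omega)

end IsSubmultiplicative

/-! ### Arithmetic progressions and `F_k(N)` -/

open scoped Pointwise

namespace ContainsAP

variable {M N : Type*} [AddCommMonoid M] {B C : Set M} {k : ℕ} {d e : M}

theorem nonempty (h : ContainsAP B k d) (hk : 1 ≤ k) : B.Nonempty := by
  obtain ⟨a, ha⟩ := h
  exact ⟨_, ha 1 le_rfl hk⟩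

theorem mono (h : ContainsAP B k d) (hBC : B ⊆ C) : ContainsAP C k d := by
  obtain ⟨a, ha⟩ := h
  exact ⟨a, fun i h1 hik => hBC (ha i h1 hik)⟩

theorem of_nonempty (hB : B.Nonempty) (k : ℕ) : ContainsAP B k 0 := by
  obtain ⟨b, hb⟩ := hB
  exact ⟨b, fun i _ _ => by simpa only [smul_zero, add_zero] using hb⟩

theorem add (hB : ContainsAP B k d) (hC : ContainsAP C k e) : ContainsAP (B + C) k (d + e) := by
  obtain ⟨b, hb⟩ := hB
  obtain ⟨c, hc⟩ := hC
  refine ⟨b + c, fun i h1 hik => ⟨_, hb i h1 hik, _, hc i h1 hik, ?_⟩⟩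
  simp only [smul_add]
  abel

theorem map [AddCommMonoid N] (h : ContainsAP B k d) (f : M →+ N) :
    ContainsAP (f '' B) k (f d) := by
  obtain ⟨a, ha⟩ := h
  exact ⟨f a, fun i h1 hik => ⟨_, ha i h1 hik, by simp only [map_add, map_nsmul]⟩⟩

theorem pi {ι : Type*} {α : ι → Type*} [∀ i, AddCommMonoid (α i)] {B : ∀ i, Set (α i)}
    {d : ∀ i, α i} (h : ∀ i, ContainsAP (B i) k (d i)) : ContainsAP (Set.univ.pi B) k d := by
  choose a ha using h
  exact ⟨a, fun j h1 hjk i _ => ha i j h1 hjk⟩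

/-- An approximate homomorphism carries a progression into a thickening of the image. -/
theorem image_add [AddCommGroup N] (h : ContainsAP B k d) (φ : M → N) {E : Set N} {e : N}
    (hφ : ∀ x, ∀ i ≤ k, φ x + i • e - φ (x + i • d) ∈ E) : ContainsAP (φ '' B + E) k e := by
  obtain ⟨a, ha⟩ := h
  exact ⟨φ a, fun i h1 hik =>
    ⟨_, Set.mem_image_of_mem φ (ha i h1 hik), _, hφ a i hik, add_sub_cancel _ _⟩⟩

end ContainsAP

theorem containsAP_image_range_smul {M : Type*} [AddCommMonoid M] [DecidableEq M] (k : ℕ)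
    (d : M) : ContainsAP ((Finset.range (k + 1)).image (· • d) : Set M) k d :=
  ⟨0, fun i _ hik => by
    rw [zero_add]
    exact Finset.mem_image_of_mem (· • d) (Finset.mem_range_succ_iff.2 hik)⟩

theorem floor_add_nsmul_floor_sub_floor_mem {R : Type*} [Ring R] [LinearOrder R]
    [IsStrictOrderedRing R] [FloorRing R] (x d : R) {i k : ℕ} (hik : i ≤ k) :
    ⌊x⌋ + i • ⌊d⌋ - ⌊x + i • d⌋ ∈ Finset.Icc (-k : ℤ) 0 := by
  have hi : (0 : R) ≤ i := i.cast_nonneg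
  have hle : ⌊x⌋ + i • ⌊d⌋ ≤ ⌊x + i • d⌋ := by
    rw [Int.le_floor]
    push_cast [nsmul_eq_mul]
    gcongr <;> exact Int.floor_le _
  have hlt : ⌊x + i • d⌋ < ⌊x⌋ + i • ⌊d⌋ + i + 1 := by
    rw [Int.floor_lt]
    calc x + i • d < (⌊x⌋ + 1) + i * (⌊d⌋ + 1) := by
          rw [nsmul_eq_mul]
          exact add_lt_add_of_lt_of_le (Int.lt_floor_add_one x)
            (mul_le_mul_of_nonneg_left (Int.lt_floor_add_one d).le hi)
      _ = _ := by
          push_cast [nsmul_eq_mul, mul_add, mul_one]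
          abel
  rw [Finset.mem_Icc]
  omega

theorem minCardAPInitial_le {k N : ℕ} {A : Finset ℤ}
    (hA : ∀ d ∈ Finset.Icc (1 : ℤ) N, ContainsAP (A : Set ℤ) k d) :
    minCardAPInitial k N ≤ A.card :=
  Nat.sInf_le ⟨A, rfl, hA⟩

theorem exists_card_eq_minCardAPInitial (k N : ℕ) :
    ∃ A : Finset ℤ, A.card = minCardAPInitial k N ∧
      ∀ d ∈ Finset.Icc (1 : ℤ) N, ContainsAP (A : Set ℤ) k d := by
  refine Nat.sInf_mem (s := {c : ℕ | ∃ A : Finset ℤ,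
    A.card = c ∧ ∀ d ∈ Finset.Icc (1 : ℤ) N, ContainsAP (A : Set ℤ) k d})
    ⟨_, (Finset.Icc (1 : ℤ) N).biUnion fun d => (Finset.range (k + 1)).image (· • d), rfl,
      fun d hd => (containsAP_image_range_smul k d).mono ?_⟩
  exact Finset.coe_subset.2
    (Finset.subset_biUnion_of_mem (fun d : ℤ => (Finset.range (k + 1)).image (· • d)) hd)

theorem exists_card_eq_minCardAPInitial_forall_le {k N : ℕ} (hk : 1 ≤ k) (hN : 1 ≤ N) :
    ∃ A : Finset ℤ, A.card = minCardAPInitial k N ∧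
      ∀ d : ℕ, d ≤ N → ContainsAP (A : Set ℤ) k d := by
  obtain ⟨A, hA, h⟩ := exists_card_eq_minCardAPInitial k N
  refine ⟨A, hA, fun d hd => ?_⟩
  rcases Nat.eq_zero_or_pos d with rfl | hd0
  · have hne : (A : Set ℤ).Nonempty := (h 1 (Finset.mem_Icc.2 (by omega))).nonempty hk
    exact_mod_cast ContainsAP.of_nonempty hne k
  · exact h d (Finset.mem_Icc.2 (by omega))

theorem one_le_minCardAPInitial {k N : ℕ} (hk : 1 ≤ k) (hN : 1 ≤ N) :
    1 ≤ minCardAPInitial k N := by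
  obtain ⟨A, hA, h⟩ := exists_card_eq_minCardAPInitial k N
  rw [← hA, Nat.one_le_iff_ne_zero, Finset.card_ne_zero, ← Finset.coe_nonempty]
  exact (h 1 (Finset.mem_Icc.2 (by omega))).nonempty hk

theorem minCardAPInitial_mono (k : ℕ) : Monotone (minCardAPInitial k) := by
  intro N M hNM
  obtain ⟨A, hA, h⟩ := exists_card_eq_minCardAPInitial k M
  rw [← hA]
  exact minCardAPInitial_le fun d hd => h d (Finset.Icc_subset_Icc_right (by omega) hd)

theorem minCardAPInitial_mul_le {k N M : ℕ} (hk : 1 ≤ k) (hN : 1 ≤ N) (hM : 1 ≤ M) :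
    minCardAPInitial k (N * M) ≤ minCardAPInitial k N * minCardAPInitial k M := by
  obtain ⟨A, hA, hA'⟩ := exists_card_eq_minCardAPInitial_forall_le hk hN
  obtain ⟨B, hB, hB'⟩ := exists_card_eq_minCardAPInitial_forall_le hk hM
  rw [← hA, ← hB]
  refine (minCardAPInitial_le (A := A + B.image (AddMonoidHom.mulLeft (N : ℤ)))
    fun d hd => ?_).trans (Finset.card_add_le.trans (Nat.mul_le_mul_left _ Finset.card_image_le))
  rw [Finset.mem_Icc] at hd
  lift d to ℕ using by omega
  have hdM : d / N ≤ M := Nat.div_le_of_le_mul (by exact_mod_cast hd.2)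
  have hd_eq : (d : ℤ) = (d % N : ℕ) + AddMonoidHom.mulLeft (N : ℤ) (d / N : ℕ) := by
    rw [AddMonoidHom.coe_mulLeft]
    exact_mod_cast (Nat.mod_add_div d N).symm
  rw [hd_eq, Finset.coe_add, Finset.coe_image]
  exact (hA' _ (Nat.mod_lt _ hN).le).add ((hB' _ hdM).map _)

theorem isSubmultiplicative_minCardAPInitial {k : ℕ} (hk : 1 ≤ k) :
    IsSubmultiplicative fun N => (minCardAPInitial k N : ℝ) where
  monotone := Nat.mono_cast.comp (minCardAPInitial_mono k)
  one_le hN := by exact_mod_cast one_le_minCardAPInitial hk hN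
  mul_le hN hM := by exact_mod_cast minCardAPInitial_mul_le hk hN hM

/-- The exponent `lim_{N → ∞} log F_k(N) / log N`, through which all the other exponents and the
dimensions are expressed. -/
noncomputable def apExponent (k : ℕ) : ℝ :=
  growthExponent fun N => (minCardAPInitial k N : ℝ)

/-! ### Greedy covering and universal hashing -/

theorem one_sub_pow_mul_lt_one {δ c : ℝ} {m : ℕ} (hδ : δ ≤ 1) (hc : 0 < c)
    (h : Real.log c < δ * m) : (1 - δ) ^ m * c < 1 := by
  calc (1 - δ) ^ m * c ≤ Real.exp (-δ) ^ m * c := by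
        gcongr
        exact Real.one_sub_le_exp_neg δ
    _ = Real.exp (Real.log c - δ * m) := by
        rw [sub_eq_neg_add, Real.exp_add, Real.exp_log hc, ← Real.exp_nat_mul]
        ring_nf
    _ < 1 := Real.exp_lt_one_iff.2 (by linarith)

section Covering

variable {G : Type*} [AddCommGroup G] [Fintype G] [DecidableEq G]

theorem exists_card_mul_card_le_card_filter_sub_mem (S U : Finset G) :
    ∃ t, U.card * S.card ≤ Fintype.card G * (U.filter fun x => x - t ∈ S).card := by
  have hsum : ∑ t : G, (U.filter fun x => x - t ∈ S).card = U.card * S.card := by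
    have hrow (x : G) : (Finset.univ.filter fun t => x - t ∈ S).card = S.card :=
      Finset.card_equiv (Equiv.subLeft x) fun t => by
        rw [Finset.mem_filter_univ, Equiv.subLeft_apply]
    simp only [Finset.card_filter] at hrow ⊢
    rw [Finset.sum_comm, Finset.sum_congr rfl fun x _ => hrow x, Finset.sum_const, smul_eq_mul]
  by_contra! hlt
  have h := Finset.sum_lt_sum_of_nonempty Finset.univ_nonempty fun t _ => hlt t
  rw [← Finset.mul_sum, hsum, Finset.sum_const, Finset.card_univ, smul_eq_mul] at h
  exact h.false

/-- Choosing each translate greedily shrinks the uncovered part by the factor `1 - #S / #G`. -/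
theorem exists_translates_card_uncovered_le (S : Finset G) (m : ℕ) :
    ∃ T : Finset G, T.card ≤ m ∧
      ((Finset.univ.filter fun x => ∀ t ∈ T, x - t ∉ S).card : ℝ) ≤
        (1 - S.card / Fintype.card G) ^ m * Fintype.card G := by
  have hG : (0 : ℝ) < Fintype.card G := by exact_mod_cast Fintype.card_pos
  have hδ : (0 : ℝ) ≤ 1 - S.card / Fintype.card G := by
    rw [sub_nonneg, div_le_one hG]
    exact_mod_cast S.card_le_univ
  induction m with
  | zero => exact ⟨∅, by simp⟩
  | succ m ih =>
    obtain ⟨T, hTm, hT⟩ := ih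
    set U := Finset.univ.filter fun x => ∀ t ∈ T, x - t ∉ S with hU
    obtain ⟨t, ht⟩ := exists_card_mul_card_le_card_filter_sub_mem S U
    refine ⟨insert t T, (Finset.card_insert_le _ _).trans (by omega), ?_⟩
    have huncovered : (Finset.univ.filter fun x => ∀ s ∈ insert t T, x - s ∉ S) =
        U.filter fun x => x - t ∉ S := by
      ext x
      simp only [hU, Finset.mem_filter, Finset.mem_univ, true_and, Finset.forall_mem_insert]
      exact and_comm
    have hsplit : ((U.filter fun x => x - t ∈ S).card : ℝ) +
        (U.filter fun x => x - t ∉ S).card = U.card := by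
      exact_mod_cast Finset.card_filter_add_card_filter_not (s := U) fun x => x - t ∈ S
    have hcovered : (U.card * (S.card / Fintype.card G) : ℝ) ≤
        (U.filter fun x => x - t ∈ S).card := by
      rw [← mul_div_assoc, div_le_iff₀' hG]
      exact_mod_cast ht
    rw [huncovered]
    calc ((U.filter fun x => x - t ∉ S).card : ℝ)
        ≤ (1 - S.card / Fintype.card G) * U.card := by linarith
      _ ≤ (1 - S.card / Fintype.card G) * ((1 - S.card / Fintype.card G) ^ m * Fintype.card G) :=
          mul_le_mul_of_nonneg_left hT hδ
      _ = _ := by ring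

end Covering

theorem exists_translates_cover {G : Type*} [AddCommGroup G] [Fintype G] {S : Finset G}
    (hS : S.Nonempty) :
    ∃ T : Finset G,
      (T.card : ℝ) ≤ Fintype.card G / S.card * Real.log (Fintype.card G) + 1 ∧
        ∀ x, ∃ t ∈ T, x - t ∈ S := by
  classical
  have hG : (0 : ℝ) < Fintype.card G := by exact_mod_cast Fintype.card_pos
  have : (0 : ℝ) < S.card := by exact_mod_cast hS.card_pos
  set r : ℝ := Fintype.card G / S.card * Real.log (Fintype.card G) with hr
  have hr0 : 0 ≤ r := by positivity
  obtain ⟨T, hTm, hT⟩ := exists_translates_card_uncovered_le S (⌊r⌋₊ + 1)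
  refine ⟨T, ?_, ?_⟩
  · calc (T.card : ℝ) ≤ ⌊r⌋₊ + 1 := by exact_mod_cast hTm
      _ ≤ r + 1 := by gcongr; exact Nat.floor_le hr0
  have hlog : Real.log (Fintype.card G) < S.card / Fintype.card G * (⌊r⌋₊ + 1 : ℕ) := by
    calc Real.log (Fintype.card G) = S.card / Fintype.card G * r := by rw [hr]; field_simp
      _ < _ := by
        push_cast
        gcongr
        exact Nat.lt_floor_add_one r
  have hδ : (S.card / Fintype.card G : ℝ) ≤ 1 :=
    div_le_one_of_le₀ (by exact_mod_cast S.card_le_univ) hG.le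
  by_contra! ⟨x, hx⟩
  have hpos : 0 < (Finset.univ.filter fun x => ∀ t ∈ T, x - t ∉ S).card :=
    Finset.card_pos.2 ⟨x, by simpa only [Finset.mem_filter_univ] using hx⟩
  exact absurd (Nat.one_le_cast.2 hpos) (not_le.2 (hT.trans_lt (one_sub_pow_mul_lt_one hδ hG hlog)))

section Hashing

variable {ι α β : Type*} [DecidableEq β]

theorem card_sq_le_card_image_mul_sum_card_fiber (D : Finset α) (f : α → β) :
    D.card ^ 2 ≤ (D.image f).card * ∑ d ∈ D, (D.filter fun e => f e = f d).card := by
  have hcard : D.card = ∑ b ∈ D.image f, (D.filter fun e => f e = b).card :=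
    Finset.card_eq_sum_card_image f D
  have hcollisions : ∑ d ∈ D, (D.filter fun e => f e = f d).card =
      ∑ b ∈ D.image f, (D.filter fun e => f e = b).card ^ 2 := by
    simp only [Finset.sum_comp (fun b => (D.filter fun e => f e = b).card) f, smul_eq_mul, sq]
  rw [hcollisions]
  nth_rewrite 1 [hcard]
  exact sq_sum_le_card_mul_sum_sq

/-- Universal hashing: if a random `f t` identifies any two given points of `D` with probability
at most `c / #D`, then some `f t` has a large image. -/
theorem exists_card_le_mul_card_image {D : Finset α} {T : Finset ι} (hT : T.Nonempty)
    {f : ι → α → β} {c : ℕ}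
    (h : ∀ d ∈ D, ∀ e ∈ D, e ≠ d → D.card * (T.filter fun t => f t e = f t d).card ≤ c * T.card) :
    ∃ t ∈ T, D.card ≤ (c + 1) * (D.image (f t)).card := by
  classical
  rcases D.eq_empty_or_nonempty with rfl | hD
  · exact ⟨hT.choose, hT.choose_spec, by simp⟩
  have hrow (d) (hd : d ∈ D) :
      ∑ e ∈ D, (T.filter fun t => f t e = f t d).card ≤ (c + 1) * T.card := by
    have herase : ∑ e ∈ D.erase d, (T.filter fun t => f t e = f t d).card ≤ c * T.card := by
      refine Nat.le_of_mul_le_mul_left ?_ hD.card_pos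
      calc _ = ∑ e ∈ D.erase d, D.card * (T.filter fun t => f t e = f t d).card :=
            Finset.mul_sum _ _ _
        _ ≤ (D.erase d).card • (c * T.card) := Finset.sum_le_card_nsmul _ _ _ fun e he =>
            h d hd e (Finset.mem_of_mem_erase he) (Finset.ne_of_mem_erase he)
        _ ≤ D.card * (c * T.card) := Nat.mul_le_mul_right _ Finset.card_erase_le
    rw [← Finset.add_sum_erase D _ hd, add_mul, one_mul, add_comm]
    exact Nat.add_le_add herase (Finset.card_filter_le _ _)
  obtain ⟨t, ht, hcollisions⟩ : ∃ t ∈ T,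
      ∑ d ∈ D, (D.filter fun e => f t e = f t d).card ≤ D.card * (c + 1) := by
    refine Finset.exists_le_of_sum_le hT ?_
    have hswap (d : α) : ∑ t ∈ T, (D.filter fun e => f t e = f t d).card =
        ∑ e ∈ D, (T.filter fun t => f t e = f t d).card := by
      simp only [Finset.card_filter]
      exact Finset.sum_comm
    rw [Finset.sum_comm, Finset.sum_congr rfl fun d _ => hswap d]
    refine (Finset.sum_le_card_nsmul _ _ _ hrow).trans_eq ?_
    simp only [Finset.sum_const, smul_eq_mul]
    ring
  refine ⟨t, ht, Nat.le_of_mul_le_mul_left ?_ hD.card_pos⟩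
  calc D.card * D.card = D.card ^ 2 := (sq _).symm
    _ ≤ _ := card_sq_le_card_image_mul_sum_card_fiber D (f t)
    _ ≤ _ := Nat.mul_le_mul_left _ hcollisions
    _ = _ := by ring

end Hashing

/-! ### Rounded dilations -/

/-- The rounded dilation `⌊P (t / q) x⌋` modulo `P`. For a random `t < q`, with `q` a large prime,
it spreads a set of `P` integers over `ZMod P`, while respecting sums up to a bounded error. -/
def roundedDilation (P q t : ℕ) (x : ℚ) : ZMod P := (⌊(P : ℚ) * (t / q) * x⌋ : ℤ)

theorem roundedDilation_add_nsmul_sub_mem (P q t : ℕ) (x d : ℚ) {i k : ℕ} (hik : i ≤ k) :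
    roundedDilation P q t x + i • roundedDilation P q t d - roundedDilation P q t (x + i • d) ∈
      (Finset.Icc (-k : ℤ) 0).image (Int.cast : ℤ → ZMod P) := by
  refine Finset.mem_image.2 ⟨_, floor_add_nsmul_floor_sub_floor_mem (P * (t / q) * x)
    ((P : ℚ) * (t / q) * d) hik, ?_⟩
  rw [← mul_smul_comm, ← mul_add]
  simp only [roundedDilation, Int.cast_sub, Int.cast_add, nsmul_eq_mul, Int.cast_mul,
    Int.cast_natCast]

theorem exists_intCast_eq_of_roundedDilation_eq {P q t : ℕ} (hP : 0 < P) (hq : 0 < q) {d e : ℤ}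
    (h : roundedDilation P q t e = roundedDilation P q t d) :
    ∃ z ∈ Finset.Icc (-(q / P : ℕ) : ℤ) (q / P : ℕ), (z : ZMod q) = t * (e - d : ℤ) := by
  obtain ⟨c, hc⟩ := (ZMod.intCast_eq_intCast_iff_dvd_sub _ _ _).1 h
  have hq' : (0 : ℚ) < q := by exact_mod_cast hq
  have hP' : (0 : ℚ) < P := by exact_mod_cast hP
  refine ⟨t * (e - d) + c * q, ?_, by simp⟩
  have hfloor : ⌊(P : ℚ) * (t / q) * e + (P * c : ℤ)⌋ = ⌊(P : ℚ) * (t / q) * d⌋ := by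
    rw [Int.floor_add_intCast, ← hc, add_sub_cancel]
  have hclose : (P : ℚ) * |(t * (e - d) + c * q : ℚ)| < q := by
    have hscale : (P : ℚ) * (t * (e - d) + c * q) =
        (P * (t / q) * e + (P * c : ℤ) - P * (t / q) * d) * q := by
      push_cast
      field_simp
      ring
    rw [← abs_of_pos hP', ← abs_mul, hscale, abs_mul, abs_of_pos hq']
    exact mul_lt_of_lt_one_left hq' (Int.abs_sub_lt_one_of_floor_eq_floor hfloor)
  have hclose' : (P : ℤ) * |t * (e - d) + c * q| < q := by exact_mod_cast hclose
  rw [Finset.mem_Icc, ← abs_le, Int.natCast_div, Int.le_ediv_iff_mul_le (by exact_mod_cast hP),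
    mul_comm]
  exact hclose'.le

theorem card_filter_natCast_mul_mem_le {q : ℕ} (hq : q.Prime) {s : ZMod q} (hs : s ≠ 0)
    (Z : Finset (ZMod q)) : ((Finset.range q).filter fun t : ℕ => t * s ∈ Z).card ≤ Z.card := by
  have : Fact q.Prime := ⟨hq⟩
  refine Finset.card_le_card_of_injOn (fun t : ℕ => (t : ZMod q) * s) (fun t ht => ?_) ?_
  · exact (Finset.mem_filter.1 ht).2
  · intro t ht u hu htu
    have ht' := Finset.mem_range.1 (Finset.mem_filter.1 ht).1
    have hu' := Finset.mem_range.1 (Finset.mem_filter.1 hu).1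
    have hcast : (t : ZMod q) = u := mul_right_cancel₀ hs htu
    rw [ZMod.natCast_eq_natCast_iff'] at hcast
    rwa [Nat.mod_eq_of_lt ht', Nat.mod_eq_of_lt hu'] at hcast

theorem mul_card_filter_roundedDilation_eq_le {P q : ℕ} (hP : 0 < P) (hq : q.Prime) (hPq : P ≤ q)
    {d e : ℤ} (hde : ¬ (q : ℤ) ∣ e - d) :
    P * ((Finset.range q).filter fun t =>
      roundedDilation P q t e = roundedDilation P q t d).card ≤ 3 * q := by
  set Z := (Finset.Icc (-(q / P : ℕ) : ℤ) (q / P : ℕ)).image (Int.cast : ℤ → ZMod q)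
  have hs : ((e - d : ℤ) : ZMod q) ≠ 0 := by rwa [Ne, ZMod.intCast_zmod_eq_zero_iff_dvd]
  have hZ : Z.card ≤ 2 * (q / P) + 1 := by
    refine Finset.card_image_le.trans ?_
    rw [Int.card_Icc]
    omega
  have hsub : ((Finset.range q).filter fun t =>
      roundedDilation P q t e = roundedDilation P q t d) ⊆
      (Finset.range q).filter fun t : ℕ => t * ((e - d : ℤ) : ZMod q) ∈ Z :=
    Finset.monotone_filter_right _ fun t _ ht =>
      Finset.mem_image.2 (exists_intCast_eq_of_roundedDilation_eq hP hq.pos ht)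
  calc _ ≤ P * (2 * (q / P) + 1) := Nat.mul_le_mul_left _
        ((Finset.card_le_card hsub).trans ((card_filter_natCast_mul_mem_le hq hs Z).trans hZ))
    _ = 2 * (P * (q / P)) + P := by ring
    _ ≤ 3 * q := by linarith [Nat.mul_div_le q P]

theorem exists_card_le_mul_card_image_roundedDilation {D : Finset ℤ} (hD : D.Nonempty) :
    ∃ q t : ℕ, D.card ≤ 4 * (D.image fun d : ℤ => roundedDilation D.card q t d).card := by
  obtain ⟨q, hq_large, hq⟩ :=
    Nat.exists_infinite_primes (D.card + 2 * ∑ d ∈ D, d.natAbs + 1)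
  have hle (d) (hd : d ∈ D) : d.natAbs ≤ ∑ d ∈ D, d.natAbs :=
    Finset.single_le_sum (f := Int.natAbs) (fun _ _ => Nat.zero_le _) hd
  have hdvd : ∀ d ∈ D, ∀ e ∈ D, e ≠ d → ¬ (q : ℤ) ∣ e - d := by
    intro d hd e he hne hdvd
    have hd' := hle d hd
    have he' := hle e he
    have := Int.eq_zero_of_abs_lt_dvd hdvd (by rw [abs_lt]; omega)
    omega
  obtain ⟨t, -, ht⟩ := exists_card_le_mul_card_image
    (f := fun t (d : ℤ) => roundedDilation D.card q t d)
    (Finset.nonempty_range_iff.2 hq.ne_zero) (c := 3) fun d hd e he hne => by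
      rw [Finset.card_range]
      exact mul_card_filter_roundedDilation_eq_le hD.card_pos hq (by omega) (hdvd d hd e he hne)
  exact ⟨q, t, ht⟩

/-! ### From arbitrary differences to initial segments -/

theorem exists_addMonoidHom_rat_injOn {G : Type*} [AddCommGroup G] [IsAddTorsionFree G]
    (D : Finset G) : ∃ f : G →+ ℚ, Set.InjOn f D := by
  obtain ⟨f, hf⟩ := Module.exists_dual_forall_apply_ne_zero (K := ℚ)
    (fun z : {z : D × D // z.1 ≠ z.2} =>
      DivisibleHull.coeAddMonoidHom G (z.1.1 : G) - DivisibleHull.coeAddMonoidHom G (z.1.2 : G))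
    fun z => sub_ne_zero.2 fun h => z.2 (Subtype.ext (DivisibleHull.coe_injective h))
  refine ⟨f.toAddMonoidHom.comp (DivisibleHull.coeAddMonoidHom G), fun x hx y hy hxy => ?_⟩
  by_contra hne
  refine hf ⟨(⟨x, hx⟩, ⟨y, hy⟩), fun h => hne (congrArg Subtype.val h)⟩ ?_
  rw [map_sub, sub_eq_zero]
  exact hxy

theorem exists_addMonoidHom_rat_injOn_mem_range_intCast {G : Type*} [AddCommGroup G]
    [IsAddTorsionFree G] (D : Finset G) :
    ∃ f : G →+ ℚ, Set.InjOn f D ∧ ∀ d ∈ D, ∃ z : ℤ, (z : ℚ) = f d := by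
  classical
  obtain ⟨f, hf⟩ := exists_addMonoidHom_rat_injOn D
  obtain ⟨b, hb⟩ :=
    IsLocalization.exist_integer_multiples_of_finset (nonZeroDivisors ℤ) (D.image f)
  have hb0 : (b : ℤ) ≠ 0 := nonZeroDivisors.ne_zero b.2
  refine ⟨(b : ℤ) • f, fun x hx y hy hxy => hf hx hy ?_, fun d hd => ?_⟩
  · exact smul_right_injective ℚ hb0 hxy
  · exact hb _ (Finset.mem_image_of_mem f hd)

theorem exists_finset_zmod_containsAP {k : ℕ} {A : Finset ℚ} {D : Finset ℤ} (hD : D.Nonempty)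
    (hA : ∀ d ∈ D, ContainsAP (A : Set ℚ) k (d : ℚ)) :
    ∃ A' S : Finset (ZMod D.card), D.card ≤ 4 * S.card ∧ A'.card ≤ A.card * (k + 1) ∧
      ∀ s ∈ S, ContainsAP (A' : Set (ZMod D.card)) k s := by
  obtain ⟨q, t, hqt⟩ := exists_card_le_mul_card_image_roundedDilation hD
  set E := (Finset.Icc (-k : ℤ) 0).image (Int.cast : ℤ → ZMod D.card)
  have hE : E.card ≤ k + 1 := Finset.card_image_le.trans (by rw [Int.card_Icc]; omega)
  refine ⟨A.image (roundedDilation D.card q t) + E, _, hqt,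
    Finset.card_add_le.trans (Nat.mul_le_mul Finset.card_image_le hE), fun s hs => ?_⟩
  obtain ⟨d, hd, rfl⟩ := Finset.mem_image.1 hs
  rw [Finset.coe_add, Finset.coe_image]
  exact (hA d hd).image_add _ fun x i hik => roundedDilation_add_nsmul_sub_mem _ _ _ x d hik

theorem exists_finset_forall_containsAP {G : Type*} [AddCommGroup G] [Fintype G]
    {k : ℕ} {A S : Finset G} (hS : S.Nonempty) (hA : ∀ s ∈ S, ContainsAP (A : Set G) k s) :
    ∃ A' : Finset G,
      (A'.card : ℝ) ≤
        A.card * ((Fintype.card G / S.card * Real.log (Fintype.card G) + 1) * (k + 1)) ∧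
      ∀ g, ContainsAP (A' : Set G) k g := by
  classical
  obtain ⟨T, hT, hTS⟩ := exists_translates_cover hS
  set E := T.biUnion fun t => (Finset.range (k + 1)).image (· • t)
  have hE : E.card ≤ T.card * (k + 1) := Finset.card_biUnion_le_card_mul _ _ _ fun t _ =>
    Finset.card_image_le.trans_eq (Finset.card_range _)
  refine ⟨A + E, ?_, fun g => ?_⟩
  · calc ((A + E).card : ℝ) ≤ A.card * (T.card * (k + 1)) := by
          exact_mod_cast Finset.card_add_le.trans (Nat.mul_le_mul_left _ hE)
      _ ≤ _ := by gcongr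
  · obtain ⟨t, ht, hgt⟩ := hTS g
    rw [← sub_add_cancel g t, Finset.coe_add]
    refine (hA _ hgt).add ((containsAP_image_range_smul k t).mono (Finset.coe_subset.2 ?_))
    exact Finset.subset_biUnion_of_mem (fun t => (Finset.range (k + 1)).image (· • t)) ht

theorem minCardAPInitial_le_of_zmod {k P : ℕ} (hP : 0 < P) {A : Finset (ZMod P)}
    (hA : ∀ g, ContainsAP (A : Set (ZMod P)) k g) :
    minCardAPInitial k P ≤ A.card * (k + 1) := by
  have : NeZero P := ⟨hP.ne'⟩
  set E := (Finset.range (k + 1)).image fun j : ℕ => (P * j : ℤ)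
  have hE : E.card ≤ k + 1 := Finset.card_image_le.trans_eq (Finset.card_range _)
  refine (minCardAPInitial_le (A := A.image (fun x => (x.val : ℤ)) + E) fun d hd => ?_).trans
    (Finset.card_add_le.trans (Nat.mul_le_mul Finset.card_image_le hE))
  rw [Finset.mem_Icc] at hd
  lift d to ℕ using by omega
  rw [Finset.coe_add, Finset.coe_image]
  refine (hA d).image_add _ fun x i hik => ?_
  have hcarry : (x.val + i * d) / P < k + 1 := by
    have hx : x.val < P := ZMod.val_lt x
    have hid : i * d ≤ k * P := Nat.mul_le_mul hik (by omega)
    rw [Nat.div_lt_iff_lt_mul hP]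
    linarith
  refine Finset.mem_coe.2 (Finset.mem_image.2 ⟨_, Finset.mem_range.2 hcarry, ?_⟩)
  have hval : (x + i • (d : ZMod P)).val = (x.val + i * d) % P := by
    rw [← ZMod.val_natCast, Nat.cast_add, Nat.cast_mul, ZMod.natCast_zmod_val, nsmul_eq_mul]
  rw [hval, eq_sub_iff_add_eq, nsmul_eq_mul]
  exact_mod_cast Nat.div_add_mod (x.val + i * d) P

theorem minCardAPInitial_card_le_of_rat {k : ℕ} {A : Finset ℚ} {D : Finset ℤ} (hD : D.Nonempty)
    (hA : ∀ d ∈ D, ContainsAP (A : Set ℚ) k (d : ℚ)) :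
    (minCardAPInitial k D.card : ℝ) ≤ (k + 1) ^ 3 * (4 * Real.log D.card + 1) * A.card := by
  have : (0 : ℝ) < D.card := by exact_mod_cast hD.card_pos
  have : NeZero D.card := ⟨hD.card_ne_zero⟩
  obtain ⟨A₁, S, hS, hA₁_card, hA₁⟩ := exists_finset_zmod_containsAP hD hA
  have hSpos : 0 < S.card := by have := hD.card_pos; omega
  obtain ⟨A₂, hA₂_card, hA₂⟩ := exists_finset_forall_containsAP (Finset.card_pos.1 hSpos) hA₁
  rw [ZMod.card] at hA₂_card
  have hdensity : (D.card / S.card : ℝ) ≤ 4 := by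
    rw [div_le_iff₀ (by exact_mod_cast hSpos)]
    exact_mod_cast hS
  calc (minCardAPInitial k D.card : ℝ) ≤ A₂.card * (k + 1) := by
        exact_mod_cast minCardAPInitial_le_of_zmod hD.card_pos hA₂
    _ ≤ (A₁.card * ((D.card / S.card * Real.log D.card + 1) * (k + 1))) * (k + 1) := by gcongr
    _ ≤ ((A.card * (k + 1)) * ((4 * Real.log D.card + 1) * (k + 1))) * (k + 1) := by
        have := Real.log_natCast_nonneg D.card
        gcongr
        exact_mod_cast hA₁_card
    _ = _ := by ring

theorem minCardAPInitial_card_le {G : Type*} [AddCommGroup G] [IsAddTorsionFree G] {k : ℕ}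
    {A D : Finset G} (hD : D.Nonempty) (hA : ∀ d ∈ D, ContainsAP (A : Set G) k d) :
    (minCardAPInitial k D.card : ℝ) ≤ (k + 1) ^ 3 * (4 * Real.log D.card + 1) * A.card := by
  classical
  obtain ⟨f, hf, hfD⟩ := exists_addMonoidHom_rat_injOn_mem_range_intCast D
  choose! z hz using hfD
  have hcard : (D.image z).card = D.card := Finset.card_image_of_injOn fun x hx y hy hxy =>
    hf hx hy (by rw [← hz x hx, ← hz y hy, hxy])
  have h := minCardAPInitial_card_le_of_rat (k := k) (A := A.image f) (hD.image z) ?_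
  · rw [hcard] at h
    refine h.trans ?_
    have := Real.log_natCast_nonneg D.card
    gcongr
    exact Finset.card_image_le
  · intro e he
    obtain ⟨d, hd, rfl⟩ := Finset.mem_image.1 he
    rw [hz d hd, Finset.coe_image]
    exact (hA d hd).map f

theorem rpow_apExponent_le {G : Type*} [AddCommGroup G] [IsAddTorsionFree G] {k : ℕ}
    (hk : 1 ≤ k) {η : ℝ} (hη : 0 < η) {A D : Finset G} (hD : D.Nonempty)
    (hA : ∀ d ∈ D, ContainsAP (A : Set G) k d) :
    (D.card : ℝ) ^ (apExponent k - η) ≤ (k + 1) ^ 3 * (4 / η + 1) * A.card := by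
  have hP : (1 : ℝ) ≤ D.card := by exact_mod_cast hD.card_pos
  have hlog : 4 * Real.log D.card + 1 ≤ (4 / η + 1) * (D.card : ℝ) ^ η := by
    calc 4 * Real.log D.card + 1 ≤ 4 * ((D.card : ℝ) ^ η / η) + (D.card : ℝ) ^ η := by
          gcongr
          · exact Real.log_le_rpow_div (by positivity) hη
          · exact Real.one_le_rpow hP hη.le
      _ = _ := by ring
  rw [Real.rpow_sub (by positivity), div_le_iff₀ (by positivity)]
  calc (D.card : ℝ) ^ apExponent k ≤ minCardAPInitial k D.card :=
        (isSubmultiplicative_minCardAPInitial hk).rpow_growthExponent_le hD.card_pos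
    _ ≤ (k + 1) ^ 3 * (4 * Real.log D.card + 1) * A.card := minCardAPInitial_card_le hD hA
    _ ≤ (k + 1) ^ 3 * ((4 / η + 1) * (D.card : ℝ) ^ η) * A.card := by gcongr
    _ = _ := by ring

/-! ### Exponents of the discrete extremal functions -/

theorem eventually_lt_log_div_log_of_rpow_le {u : ℕ → ℝ} {a b C : ℝ} (hab : a < b) (hC : 0 < C)
    (h : ∀ᶠ N : ℕ in atTop, (N : ℝ) ^ b ≤ C * u N) :
    ∀ᶠ N : ℕ in atTop, a < Real.log (u N) / Real.log N := by
  have hlog : Tendsto (fun N : ℕ => Real.log N) atTop atTop :=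
    Real.tendsto_log_atTop.comp tendsto_natCast_atTop_atTop
  have hlim : Tendsto (fun N : ℕ => b - Real.log C / Real.log N) atTop (𝓝 b) := by
    simpa only [sub_zero] using tendsto_const_nhds.sub (hlog.const_div_atTop (Real.log C))
  filter_upwards [hlim.eventually_const_lt hab, h, eventually_ge_atTop 2] with N hNa hNu hN
  have hN0 : (0 : ℝ) < N := by positivity
  have hu : 0 < u N := pos_of_mul_pos_right ((Real.rpow_pos_of_pos hN0 b).trans_le hNu) hC.le
  refine hNa.trans_le ?_
  rw [sub_le_iff_le_add, ← add_div, le_div_iff₀ (Real.log_pos (by exact_mod_cast hN)),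
    ← Real.log_rpow hN0, ← Real.log_mul hu.ne' hC.ne', mul_comm (u N)]
  exact Real.log_le_log (by positivity) hNu

theorem tendsto_log_div_log_of_rpow_le {u v : ℕ → ℝ} {β : ℝ}
    (hu : ∀ η > 0, ∃ C > 0, ∀ᶠ N : ℕ in atTop, (N : ℝ) ^ (β - η) ≤ C * u N)
    (huv : ∀ᶠ N in atTop, u N ≤ v N)
    (hv : Tendsto (fun N : ℕ => Real.log (v N) / Real.log N) atTop (𝓝 β)) :
    Tendsto (fun N : ℕ => Real.log (u N) / Real.log N) atTop (𝓝 β) := by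
  refine tendsto_order.2 ⟨fun a ha => ?_, fun a ha => ?_⟩
  · obtain ⟨C, hC, h⟩ := hu ((β - a) / 2) (by linarith)
    exact eventually_lt_log_div_log_of_rpow_le (by linarith) hC h
  · obtain ⟨C, hC, h⟩ := hu 1 one_pos
    filter_upwards [hv.eventually_lt_const ha, h, huv, eventually_ge_atTop 1]
      with N hNa hNu hNv hN
    have hN0 : (0 : ℝ) < N := by positivity
    have hu0 : 0 < u N :=
      pos_of_mul_pos_right ((Real.rpow_pos_of_pos hN0 _).trans_le hNu) hC.le
    exact (div_le_div_of_nonneg_right (Real.log_le_log hu0 hNv)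
      (Real.log_natCast_nonneg N)).trans_lt hNa

theorem tendsto_log_minCardAPInitial {k : ℕ} (hk : 1 ≤ k) :
    Tendsto (fun N : ℕ => Real.log (minCardAPInitial k N) / Real.log N) atTop
      (𝓝 (apExponent k)) :=
  (isSubmultiplicative_minCardAPInitial hk).tendsto_log_div_log

theorem exists_finset_pi_containsAP (n : ℕ) {k N : ℕ} (hk : 1 ≤ k) (hN : 1 ≤ N) :
    ∃ A : Finset (Fin n → ℝ), A.card ≤ minCardAPInitial k N ^ n ∧
      ∀ d : Fin n → ℕ, (∀ i, d i ≤ N) →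
        ContainsAP (A : Set (Fin n → ℝ)) k (fun i => (d i : ℝ)) := by
  classical
  obtain ⟨A, hA, h⟩ := exists_card_eq_minCardAPInitial_forall_le hk hN
  refine ⟨(Fintype.piFinset fun _ => A).image ((Int.castAddHom ℝ).compLeft (Fin n)), ?_,
    fun d hd => ?_⟩
  · exact Finset.card_image_le.trans_eq (by simp [hA])
  · rw [Finset.coe_image, Fintype.coe_piFinset]
    exact (ContainsAP.pi fun i => h (d i) (hd i)).map ((Int.castAddHom ℝ).compLeft (Fin n))

theorem exists_finset_minCardAPDim_le (n : ℕ) {k N : ℕ} (hk : 1 ≤ k) (hN : 1 ≤ N) :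
    ∃ (A : Finset (Fin n → ℝ)) (D : Finset (Fin n → ℕ)),
      A.card ≤ minCardAPInitial k N ^ n ∧ D.card = N ^ n ∧
        ∀ d ∈ D, ContainsAP (A : Set (Fin n → ℝ)) k (fun i => (d i : ℝ)) := by
  obtain ⟨A, hA, h⟩ := exists_finset_pi_containsAP n hk hN
  refine ⟨A, Fintype.piFinset fun _ => Finset.range N, hA, by simp, fun d hd => h d fun i => ?_⟩
  exact (Finset.mem_range.1 (Fintype.mem_piFinset.1 hd i)).le

theorem minCardAPDim_le (n : ℕ) {k N : ℕ} (hk : 1 ≤ k) (hN : 1 ≤ N) :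
    minCardAPDim n k N ≤ minCardAPInitial k N ^ n := by
  obtain ⟨A, D, hA, hD, h⟩ := exists_finset_minCardAPDim_le n hk hN
  exact (Nat.sInf_le ⟨A, D, rfl, hD, h⟩ : minCardAPDim n k N ≤ A.card).trans hA

theorem exists_card_eq_minCardAPDim (n : ℕ) {k N : ℕ} (hk : 1 ≤ k) (hN : 1 ≤ N) :
    ∃ (A : Finset (Fin n → ℝ)) (D : Finset (Fin n → ℕ)),
      A.card = minCardAPDim n k N ∧ D.card = N ^ n ∧
        ∀ d ∈ D, ContainsAP (A : Set (Fin n → ℝ)) k (fun i => (d i : ℝ)) := by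
  obtain ⟨A, D, -, hD, h⟩ := exists_finset_minCardAPDim_le n hk hN
  exact Nat.sInf_mem (s := {c : ℕ | ∃ (A : Finset (Fin n → ℝ)) (D : Finset (Fin n → ℕ)),
    A.card = c ∧ D.card = N ^ n ∧
      ∀ d ∈ D, ContainsAP (A : Set (Fin n → ℝ)) k (fun i => (d i : ℝ))}) ⟨_, A, D, rfl, hD, h⟩

theorem exists_finset_card_eq_containsAP (k N : ℕ) :
    ∃ A D : Finset ℤ, A.card = minCardAPInitial k N ∧ D.card = N ∧
      ∀ d ∈ D, ContainsAP (A : Set ℤ) k d := by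
  obtain ⟨A, hA, h⟩ := exists_card_eq_minCardAPInitial k N
  exact ⟨A, Finset.Icc 1 N, hA, by simp, h⟩

theorem minCardAPDistinct_le (k N : ℕ) : minCardAPDistinct k N ≤ minCardAPInitial k N :=
  Nat.sInf_le (exists_finset_card_eq_containsAP k N)

theorem exists_card_eq_minCardAPDistinct (k N : ℕ) :
    ∃ A D : Finset ℤ, A.card = minCardAPDistinct k N ∧ D.card = N ∧
      ∀ d ∈ D, ContainsAP (A : Set ℤ) k d :=
  Nat.sInf_mem (s := {c : ℕ | ∃ A D : Finset ℤ,
    A.card = c ∧ D.card = N ∧ ∀ d ∈ D, ContainsAP (A : Set ℤ) k d})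
    ⟨_, exists_finset_card_eq_containsAP k N⟩

theorem tendsto_log_minCardAPDistinct {k : ℕ} (hk : 1 ≤ k) :
    Tendsto (fun N : ℕ => Real.log (minCardAPDistinct k N) / Real.log N) atTop
      (𝓝 (apExponent k)) := by
  refine tendsto_log_div_log_of_rpow_le (fun η hη =>
      ⟨(k + 1) ^ 3 * (4 / η + 1), by positivity, ?_⟩)
    (.of_forall fun N => Nat.cast_le.2 (minCardAPDistinct_le k N))
    (tendsto_log_minCardAPInitial hk)
  filter_upwards [eventually_ge_atTop 1] with N hN
  obtain ⟨A, D, hA, hD, h⟩ := exists_card_eq_minCardAPDistinct k N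
  have hD0 : D.Nonempty := Finset.card_pos.1 (by omega)
  simpa only [hA, hD] using rpow_apExponent_le hk hη hD0 h

theorem tendsto_log_minCardAPDim (n : ℕ) {k : ℕ} (hk : 1 ≤ k) :
    Tendsto (fun N : ℕ => Real.log (minCardAPDim n k N) / Real.log N) atTop
      (𝓝 (n * apExponent k)) := by
  have hpow : Tendsto (fun N : ℕ => Real.log ((minCardAPInitial k N : ℝ) ^ n) / Real.log N)
      atTop (𝓝 (n * apExponent k)) := by
    simpa only [Real.log_pow, mul_div_assoc] using
      (tendsto_log_minCardAPInitial hk).const_mul (n : ℝ)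
  refine tendsto_log_div_log_of_rpow_le (fun η hη =>
      ⟨(k + 1) ^ 3 * (4 / (η / (n + 1)) + 1), by positivity, ?_⟩)
    ((eventually_ge_atTop 1).mono fun N hN => by exact_mod_cast minCardAPDim_le n hk hN) hpow
  filter_upwards [eventually_ge_atTop 1] with N hN
  obtain ⟨A, D, hA, hD, h⟩ := exists_card_eq_minCardAPDim n hk hN
  let cast : (Fin n → ℕ) ↪ (Fin n → ℝ) :=
    ⟨fun d i => d i, Nat.cast_injective.comp_left⟩
  have hD0 : (D.map cast).Nonempty :=
    (Finset.card_pos.1 (hD ▸ Nat.pow_pos hN)).map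
  have hexp : n * apExponent k - η ≤ n * (apExponent k - η / (n + 1)) := by
    have : n * (η / (n + 1)) ≤ η := by
      rw [mul_div_assoc', div_le_iff₀ (by positivity)]
      nlinarith
    linarith
  calc (N : ℝ) ^ (n * apExponent k - η)
      ≤ (N : ℝ) ^ (n * (apExponent k - η / (n + 1))) :=
        Real.rpow_le_rpow_of_exponent_le (by exact_mod_cast hN) hexp
    _ = ((D.map cast).card : ℝ) ^ (apExponent k - η / (n + 1)) := by
        rw [Finset.card_map, hD, Nat.cast_pow, Real.rpow_natCast_mul (by positivity)]
    _ ≤ _ := hA ▸ rpow_apExponent_le hk (by positivity) hD0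
        (Finset.forall_mem_map.2 h)

/-! ### Digit sets and the upper bound -/

/-- The points of `V` with a generalized base-`b` expansion `∑ⱼ a_j b^{-(j+1)}` whose digits all
belong to `A`: the self-similar set `E = b⁻¹(A + E)` used for the upper bound. -/
def digitSet {V : Type*} [NormedAddCommGroup V] [NormedSpace ℝ V] (A : Finset V) (b : ℕ) :
    Set V :=
  {x | ∃ a : ℕ → V, (∀ j, a j ∈ A) ∧ HasSum (fun j => ((b : ℝ) ^ (j + 1))⁻¹ • a j) x}

theorem summable_inv_pow_succ {b : ℕ} (hb : 2 ≤ b) :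
    Summable fun j : ℕ => ((b : ℝ) ^ (j + 1))⁻¹ := by
  simp_rw [← inv_pow]
  exact (summable_nat_add_iff 1).2 (summable_geometric_of_lt_one (by positivity)
    (inv_lt_one_of_one_lt₀ (by exact_mod_cast hb)))

section DigitSet

variable {V : Type*} [NormedAddCommGroup V] [NormedSpace ℝ V] {A : Finset V} {b k : ℕ}

theorem isBounded_digitSet (hb : 2 ≤ b) : Bornology.IsBounded (digitSet A b) := by
  obtain ⟨R, hR⟩ := A.finite_toSet.isBounded.exists_norm_le
  refine isBounded_iff_forall_norm_le.2 ⟨_, fun x ⟨a, ha, hx⟩ =>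
    hx.norm_le_of_bounded ((summable_inv_pow_succ hb).mul_right R).hasSum fun j => ?_⟩
  rw [norm_smul, Real.norm_of_nonneg (by positivity)]
  exact mul_le_mul_of_nonneg_left (hR _ (ha j)) (by positivity)

theorem digitSet_subset_smul_add (hb : b ≠ 0) :
    digitSet A b ⊆ (b : ℝ)⁻¹ • ((A : Set V) + digitSet A b) := by
  have hb0 : (b : ℝ) ≠ 0 := Nat.cast_ne_zero.2 hb
  rintro x ⟨a, ha, hx⟩
  rw [Set.mem_inv_smul_set_iff₀ hb0]
  have htail := ((hasSum_nat_add_iff' 1).2 hx).const_smul (b : ℝ)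
  simp only [Finset.sum_range_one, zero_add, pow_one, smul_sub, smul_inv_smul₀ hb0] at htail
  refine ⟨a 0, ha 0, _, ⟨fun j => a (j + 1), fun j => ha _, htail.congr_fun fun j => ?_⟩,
    add_sub_cancel _ _⟩
  rw [pow_succ' _ (j + 1), mul_inv, mul_smul, smul_inv_smul₀ hb0]

theorem exists_card_le_digitSet_subset_add_smul (hA : A.Nonempty) (hb : b ≠ 0) (m : ℕ) :
    ∃ T : Finset V, T.Nonempty ∧ T.card ≤ A.card ^ m ∧
      digitSet A b ⊆ T + ((b : ℝ) ^ m)⁻¹ • digitSet A b := by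
  classical
  induction m with
  | zero => exact ⟨{0}, Finset.singleton_nonempty 0, by simp, by simp⟩
  | succ m ih =>
    obtain ⟨T, hT, hcard, hsub⟩ := ih
    refine ⟨T + ((b : ℝ) ^ (m + 1))⁻¹ • A, hT.add hA.smul_finset, ?_, hsub.trans ?_⟩
    · exact Finset.card_add_le.trans (Nat.mul_le_mul hcard Finset.card_image_le)
    · rw [Finset.coe_add, Finset.coe_smul_finset, add_assoc, ← smul_add, pow_succ, mul_inv,
        mul_smul]
      gcongr
      exact digitSet_subset_smul_add hb

theorem containsAP_digitSet [CompleteSpace V] (hk : 1 ≤ k) (hb : 2 ≤ b) {δ : ℕ → V} {d : V}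
    (h : ∀ j, ContainsAP (A : Set V) k (δ j))
    (hd : HasSum (fun j => ((b : ℝ) ^ (j + 1))⁻¹ • δ j) d) :
    ContainsAP (digitSet A b) k d := by
  choose a ha using h
  obtain ⟨R, hR⟩ := A.finite_toSet.isBounded.exists_norm_le
  have hsum : Summable fun j => ((b : ℝ) ^ (j + 1))⁻¹ • (a j + δ j) := by
    refine .of_norm_bounded ((summable_inv_pow_succ hb).mul_right R) fun j => ?_
    rw [norm_smul, Real.norm_of_nonneg (by positivity)]
    have haδ : a j + δ j ∈ (A : Set V) := by simpa only [one_smul] using ha j 1 le_rfl hk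
    exact mul_le_mul_of_nonneg_left (hR _ haδ) (by positivity)
  obtain ⟨s, hs⟩ := hsum
  refine ⟨s - d, fun i h1 hik => ⟨fun j => a j + i • δ j, fun j => ha j i h1 hik,
    ((hs.sub hd).add (hd.const_smul i)).congr_fun fun j => ?_⟩⟩
  simp only [smul_add, smul_comm i, add_sub_cancel_right]

end DigitSet

theorem boxNumber_le {n : ℕ} {E : Set (Fin n → ℝ)} {ε : ℝ} {m : ℕ} (hm : 0 < m)
    (h : CoveredByBoxes E ε m) : boxNumber E ε ≤ m :=
  iInf₂_le m ⟨hm, h⟩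

theorem boxNumber_anti {n : ℕ} (E : Set (Fin n → ℝ)) : Antitone (boxNumber E) :=
  fun _ _ hεδ => le_iInf₂ fun _ ⟨hm, a, b, hab, hE⟩ =>
    boxNumber_le hm ⟨a, b, fun j i => ⟨(hab j i).1, (hab j i).2.trans hεδ⟩, hE⟩

theorem boxNumber_le_of_subset_add {n : ℕ} {T : Finset (Fin n → ℝ)} (hT : T.Nonempty)
    {E U : Set (Fin n → ℝ)} {r : ℝ} (hr : 0 ≤ r) (hU : ∀ u ∈ U, ‖u‖ ≤ r) (hE : E ⊆ T + U) :
    boxNumber E (2 * r) ≤ T.card := by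
  let c : Fin T.card → Fin n → ℝ := fun j => T.equivFin.symm j
  refine boxNumber_le hT.card_pos ⟨fun j i => c j i - r, fun j i => c j i + r,
    fun j i => ⟨by linarith, by linarith⟩, fun x hx => ?_⟩
  obtain ⟨t, ht, u, hu, rfl⟩ := hE hx
  refine Set.mem_iUnion.2 ⟨T.equivFin ⟨t, ht⟩, ?_⟩
  have hur : ∀ i, |u i| ≤ r := fun i => (norm_le_pi_norm u i).trans (hU u hu)
  simp only [c, Equiv.symm_apply_apply]
  constructor <;> intro i <;> simp only [Pi.add_apply] <;> linarith [abs_le.1 (hur i)]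

theorem log_boxNumber_le {n b M : ℕ} {E : Set (Fin n → ℝ)} {C ε : ℝ} (hb : 2 ≤ b) (hM : 1 ≤ M)
    (hC : 0 < C) (h : ∀ m : ℕ, boxNumber E (C * ((b : ℝ) ^ m)⁻¹) ≤ (M ^ m : ℕ)) (hε : 0 < ε)
    (hCε : 0 ≤ Real.log C + Real.log (1 / ε)) :
    ENNReal.log (boxNumber E ε) ≤
      (((Real.log C + Real.log (1 / ε)) / Real.log b + 1) * Real.log M : ℝ) := by
  have hlogb : 0 < Real.log b := Real.log_pos (by exact_mod_cast hb)
  set y := (Real.log C + Real.log (1 / ε)) / Real.log b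
  set m := ⌈y⌉₊
  have hscale : C * ((b : ℝ) ^ m)⁻¹ ≤ ε := by
    have hym : Real.log (C * (1 / ε)) ≤ Real.log ((b : ℝ) ^ m) := by
      rw [Real.log_mul hC.ne' (by positivity), Real.log_pow, ← div_le_iff₀ hlogb]
      exact Nat.le_ceil y
    have hpow := (Real.log_le_log_iff (by positivity) (by positivity)).1 hym
    rwa [mul_one_div, div_le_iff₀ hε, mul_comm, ← div_le_iff₀ (by positivity),
      div_eq_mul_inv] at hpow
  have hbox : (boxNumber E ε : ENNReal) ≤ ENNReal.ofReal ((M : ℝ) ^ m) := by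
    rw [← Nat.cast_pow, ENNReal.ofReal_natCast]
    exact_mod_cast ENat.toENNReal_mono ((boxNumber_anti E hscale).trans (h m))
  calc ENNReal.log (boxNumber E ε) ≤ ENNReal.log (ENNReal.ofReal ((M : ℝ) ^ m)) :=
        ENNReal.log_monotone hbox
    _ = (m * Real.log M : ℝ) := by
        rw [ENNReal.log_ofReal_of_pos (by positivity), Real.log_pow]
    _ ≤ _ := by
        rw [EReal.coe_le_coe_iff]
        exact mul_le_mul_of_nonneg_right (Nat.ceil_lt_add_one (by positivity)).le
          (Real.log_natCast_nonneg M)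

theorem tendsto_log_one_div_nhdsGT_zero :
    Tendsto (fun ε : ℝ => Real.log (1 / ε)) (𝓝[>] 0) atTop := by
  simp only [one_div]
  exact Real.tendsto_log_atTop.comp tendsto_inv_nhdsGT_zero

theorem minkowskiDim_le_of_boxNumber_le {n b M : ℕ} {E : Set (Fin n → ℝ)} {C : ℝ} (hb : 2 ≤ b)
    (hM : 1 ≤ M) (hC : 0 < C)
    (h : ∀ m : ℕ, boxNumber E (C * ((b : ℝ) ^ m)⁻¹) ≤ (M ^ m : ℕ)) :
    minkowskiDim E ≤ (Real.log M / Real.log b : ℝ) := by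
  set g : ℝ → ℝ := fun L => (Real.log C / Real.log b + 1) * Real.log M / L +
    Real.log M / Real.log b
  have hg : Tendsto (fun ε => g (Real.log (1 / ε))) (𝓝[>] 0) (𝓝 (Real.log M / Real.log b)) := by
    simpa only [zero_add] using
      (tendsto_log_one_div_nhdsGT_zero.const_div_atTop _).add_const (Real.log M / Real.log b)
  rw [← (EReal.tendsto_coe.2 hg).limsup_eq]
  refine limsup_le_limsup ?_
  filter_upwards [self_mem_nhdsWithin, tendsto_log_one_div_nhdsGT_zero.eventually_gt_atTop 0,
    tendsto_log_one_div_nhdsGT_zero.eventually_ge_atTop (-Real.log C)] with ε hε hL hCε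
  refine (EReal.div_le_div_right_of_nonneg (by exact_mod_cast hL.le)
    (log_boxNumber_le hb hM hC h hε (by linarith))).trans_eq ?_
  rw [← EReal.coe_div]
  congr 1
  simp only [g]
  field_simp
  ring

theorem minkowskiDim_digitSet_le {n b : ℕ} {A : Finset (Fin n → ℝ)} (hA : A.Nonempty)
    (hb : 2 ≤ b) : minkowskiDim (digitSet A b) ≤ (Real.log A.card / Real.log b : ℝ) := by
  obtain ⟨R, hR0, hR⟩ := (isBounded_digitSet (A := A) hb).exists_pos_norm_le
  refine minkowskiDim_le_of_boxNumber_le (C := 2 * R) hb hA.card_pos (by positivity) fun m => ?_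
  obtain ⟨T, hT, hcard, hsub⟩ := exists_card_le_digitSet_subset_add_smul hA (b := b) (by omega) m
  rw [mul_assoc]
  refine (boxNumber_le_of_subset_add hT (by positivity) ?_ hsub).trans (by exact_mod_cast hcard)
  rintro _ ⟨x, hx, rfl⟩
  rw [norm_smul, Real.norm_of_nonneg (by positivity), mul_comm]
  exact mul_le_mul_of_nonneg_right (hR x hx) (by positivity)

theorem containsAllAPs_digitSet {n k b : ℕ} {A : Finset (Fin n → ℝ)} (hk : 1 ≤ k) (hb : 2 ≤ b)
    (hA : ∀ d : Fin n → ℕ, (∀ i, d i ≤ b) →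
      ContainsAP (A : Set (Fin n → ℝ)) k (fun i => (d i : ℝ))) :
    ContainsAllAPs (digitSet A b) k := by
  intro d hd
  choose δ _ hδ using fun i => Real.ofDigits_SurjOn (b := b) (by omega) ⟨hd.1 i, hd.2 i⟩
  refine containsAP_digitSet hk hb (δ := fun j i => ((δ i j : ℕ) : ℝ))
    (fun j => hA (fun i => δ i j) fun i => (δ i j).2.le) (Pi.hasSum.2 fun i => ?_)
  rw [← hδ i]
  exact Real.summable_ofDigitsTerm.hasSum.congr_fun fun j => mul_comm _ _

theorem minkowskiAP_le_log_div_log (n : ℕ) {k b : ℕ} (hk : 1 ≤ k) (hb : 2 ≤ b) :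
    minkowskiAP n k ≤
      (n * (Real.log (minCardAPInitial k b) / Real.log b) : ℝ) := by
  obtain ⟨A, hcard, hA⟩ := exists_finset_pi_containsAP n hk (by omega : 1 ≤ b)
  have hA0 : A.Nonempty :=
    Finset.coe_nonempty.1 ((hA 0 fun _ => Nat.zero_le b).nonempty hk)
  calc minkowskiAP n k ≤ minkowskiDim (digitSet A b) :=
        iInf₂_le (digitSet A b) (containsAllAPs_digitSet hk hb hA)
    _ ≤ (Real.log A.card / Real.log b : ℝ) := minkowskiDim_digitSet_le hA0 hb
    _ ≤ _ := by
      rw [EReal.coe_le_coe_iff, mul_div_assoc', ← Real.log_pow]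
      exact div_le_div_of_nonneg_right
        (Real.log_le_log (by exact_mod_cast hA0.card_pos) (by exact_mod_cast hcard))
        (Real.log_natCast_nonneg b)

theorem minkowskiAP_le (n : ℕ) {k : ℕ} (hk : 1 ≤ k) :
    minkowskiAP n k ≤ (n * apExponent k : ℝ) := by
  refine ge_of_tendsto
    (EReal.tendsto_coe.2 ((tendsto_log_minCardAPInitial hk).const_mul (n : ℝ))) ?_
  filter_upwards [eventually_ge_atTop 2] with b hb
  exact minkowskiAP_le_log_div_log n hk hb

/-! ### Grid rounding and the lower bound -/

theorem exists_coveredByBoxes_of_boxNumber_le {n m : ℕ} {E : Set (Fin n → ℝ)} {ε : ℝ}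
    (h : boxNumber E ε ≤ m) : ∃ l ≤ m, CoveredByBoxes E ε l := by
  have hlt : boxNumber E ε < (m + 1 : ℕ) := h.trans_lt (by exact_mod_cast m.lt_succ_self)
  simp only [boxNumber, iInf_lt_iff] at hlt
  obtain ⟨l, ⟨-, hcov⟩, hl⟩ := hlt
  exact ⟨l, Nat.lt_succ_iff.1 (by exact_mod_cast hl), hcov⟩

theorem one_le_boxNumber {n : ℕ} (E : Set (Fin n → ℝ)) (ε : ℝ) : 1 ≤ boxNumber E ε :=
  le_iInf₂ fun _ h => by exact_mod_cast h.1

theorem minkowskiDim_nonneg {n : ℕ} (E : Set (Fin n → ℝ)) : 0 ≤ minkowskiDim E := by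
  refine le_limsup_of_frequently_le (Eventually.frequently ?_)
  filter_upwards [tendsto_log_one_div_nhdsGT_zero.eventually_ge_atTop 0] with ε hε
  refine EReal.div_nonneg (ENNReal.zero_le_log_iff.2 ?_) (by exact_mod_cast hε)
  exact_mod_cast ENat.toENNReal_mono (one_le_boxNumber E ε)

theorem eventually_exists_coveredByBoxes {n : ℕ} {E : Set (Fin n → ℝ)} {s : ℝ}
    (hs : minkowskiDim E < s) :
    ∀ᶠ ε : ℝ in 𝓝[>] 0, ∃ m : ℕ, CoveredByBoxes E ε m ∧ (m : ℝ) ≤ (1 / ε) ^ s := by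
  filter_upwards [eventually_lt_of_limsup_lt hs, self_mem_nhdsWithin,
    tendsto_log_one_div_nhdsGT_zero.eventually_gt_atTop 0] with ε h hε hlog
  have hε0 : 0 < 1 / ε := one_div_pos.2 hε
  rw [EReal.div_lt_iff (by exact_mod_cast hlog) (EReal.coe_ne_top _), ← EReal.coe_mul,
    ← Real.log_rpow hε0, ← ENNReal.log_ofReal_of_pos (by positivity),
    ENNReal.log_lt_log_iff] at h
  have hfin : boxNumber E ε ≠ ⊤ := fun htop => by
    rw [htop, ENat.toENNReal_top] at h
    exact not_top_lt h
  obtain ⟨M, hM⟩ := ENat.ne_top_iff_exists.1 hfin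
  obtain ⟨m, hmM, hcov⟩ := exists_coveredByBoxes_of_boxNumber_le hM.ge
  rw [← hM, ENat.toENNReal_coe, ← ENNReal.ofReal_natCast,
    ENNReal.ofReal_lt_ofReal_iff (by positivity)] at h
  exact ⟨m, hcov, (Nat.cast_le.2 hmM).trans h.le⟩

/-- The index of the cell of the grid `N⁻¹ ℤⁿ` that contains `x`. It serves to replace subsets
of `ℝⁿ` by finite sets of lattice points. -/
noncomputable def gridCell {n : ℕ} (N : ℕ) (x : Fin n → ℝ) : Fin n → ℤ :=
  fun i => ⌊(N : ℝ) * x i⌋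

theorem gridCell_mono {n : ℕ} (N : ℕ) : Monotone (gridCell N : (Fin n → ℝ) → Fin n → ℤ) :=
  fun _ _ hxy i => Int.floor_mono (mul_le_mul_of_nonneg_left (hxy i) N.cast_nonneg)

theorem containsAP_gridCell {n k : ℕ} {B : Set (Fin n → ℝ)} {d : Fin n → ℝ}
    (h : ContainsAP B k d) (N : ℕ) :
    ContainsAP (gridCell N '' B + Set.univ.pi fun _ => Finset.Icc (-k : ℤ) 0) k
      (gridCell N d) := by
  refine h.image_add _ fun x i hik j _ => ?_
  simpa only [gridCell, Finset.mem_coe, Pi.sub_apply, Pi.add_apply, Pi.smul_apply, mul_add,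
    mul_smul_comm] using floor_add_nsmul_floor_sub_floor_mem (N * x j) (N * d j) hik

theorem gridCell_mem_piFinset_Icc {n N : ℕ} {a b x : Fin n → ℝ} (hx : x ∈ Set.Icc a b)
    (hab : ∀ i, b i - a i ≤ 1 / N) :
    gridCell N x ∈ Fintype.piFinset fun i => Finset.Icc (gridCell N a i) (gridCell N a i + 1) := by
  refine Fintype.mem_piFinset.2 fun i => Finset.mem_Icc.2 ⟨gridCell_mono N hx.1 i, ?_⟩
  rw [gridCell, gridCell, ← Int.floor_add_one]
  refine Int.floor_mono ?_
  calc N * x i ≤ N * (a i + 1 / N) := by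
        gcongr
        linarith [hx.2 i, hab i]
    _ ≤ N * a i + 1 := by
        rw [mul_add]
        gcongr
        exact (mul_one_div _ _).trans_le (div_self_le_one _)

theorem exists_image_gridCell_subset {n m N : ℕ} {E : Set (Fin n → ℝ)}
    (h : CoveredByBoxes E (1 / (N : ℝ)) m) :
    ∃ A : Finset (Fin n → ℤ), A.card ≤ m * 2 ^ n ∧ gridCell N '' E ⊆ A := by
  classical
  obtain ⟨a, b, hab, hE⟩ := h
  refine ⟨Finset.univ.biUnion fun j => Fintype.piFinset fun i =>
    Finset.Icc (gridCell N (a j) i) (gridCell N (a j) i + 1), ?_, ?_⟩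
  · refine (Finset.card_biUnion_le_card_mul _ _ (2 ^ n) fun j _ => ?_).trans_eq (by simp)
    simp [Fintype.card_piFinset, add_assoc]
  · rintro _ ⟨x, hx, rfl⟩
    obtain ⟨j, hj⟩ := Set.mem_iUnion.1 (hE hx)
    exact Finset.mem_biUnion.2
      ⟨j, Finset.mem_univ j, gridCell_mem_piFinset_Icc hj fun i => (hab j i).2⟩

theorem eventually_exists_image_gridCell_subset {n : ℕ} {E : Set (Fin n → ℝ)} {s : ℝ}
    (hs : minkowskiDim E < s) :
    ∀ᶠ N : ℕ in atTop, ∃ A : Finset (Fin n → ℤ),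
      (A.card : ℝ) ≤ 2 ^ n * (N : ℝ) ^ s ∧ gridCell N '' E ⊆ A := by
  have hlim : Tendsto (fun N : ℕ => 1 / (N : ℝ)) atTop (𝓝[>] 0) := by
    simp only [one_div]
    exact tendsto_inv_atTop_nhdsGT_zero.comp tendsto_natCast_atTop_atTop
  filter_upwards [hlim.eventually (eventually_exists_coveredByBoxes hs)] with N ⟨m, hm, hmN⟩
  rw [one_div_one_div] at hmN
  obtain ⟨A, hA, hEA⟩ := exists_image_gridCell_subset hm
  refine ⟨A, ?_, hEA⟩
  calc (A.card : ℝ) ≤ m * 2 ^ n := by exact_mod_cast hA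
    _ ≤ (N : ℝ) ^ s * 2 ^ n := by gcongr
    _ = _ := mul_comm _ _

theorem eventually_exists_image_gridCell_accumulate_subset {n : ℕ}
    {S : ℕ → Set (Fin n → ℝ)} {s : ℝ} (hs : ∀ j, minkowskiDim (S j) < s) (J : ℕ) :
    ∀ᶠ N : ℕ in atTop, ∃ A : Finset (Fin n → ℤ),
      (A.card : ℝ) ≤ (J + 1) * (2 ^ n * (N : ℝ) ^ s) ∧
        gridCell N '' Set.accumulate S J ⊆ A := by
  classical
  induction J with
  | zero => simpa using eventually_exists_image_gridCell_subset (hs 0)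
  | succ J ih =>
    filter_upwards [ih, eventually_exists_image_gridCell_subset (hs (J + 1))]
      with N ⟨A, hA, hSA⟩ ⟨A', hA', hSA'⟩
    refine ⟨A ∪ A', ?_, ?_⟩
    · calc ((A ∪ A').card : ℝ) ≤ A.card + A'.card := by exact_mod_cast Finset.card_union_le A A'
        _ ≤ (J + 1) * (2 ^ n * (N : ℝ) ^ s) + 2 ^ n * (N : ℝ) ^ s := add_le_add hA hA'
        _ = _ := by
          push_cast
          ring
    · rw [Set.accumulate_succ, Set.image_union, Finset.coe_union]
      exact Set.union_subset_union hSA hSA'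

theorem volume_le_card_mul_of_image_gridCell_subset {n N : ℕ} (hN : 1 ≤ N)
    {Δ : Set (Fin n → ℝ)} {D : Finset (Fin n → ℤ)} (hD : gridCell N '' Δ ⊆ D) :
    MeasureTheory.volume.real Δ * (N : ℝ) ^ n ≤ D.card := by
  have hN0 : (0 : ℝ) < N := by positivity
  let cell : (Fin n → ℤ) → Set (Fin n → ℝ) := fun z =>
    Set.Icc (fun i => (z i : ℝ) / N) (fun i => ((z i : ℝ) + 1) / N)
  have hcell : ∀ z, MeasureTheory.volume.real (cell z) = ((N : ℝ) ^ n)⁻¹ := fun z => by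
    have hle : (fun i => (z i : ℝ) / N) ≤ fun i => ((z i : ℝ) + 1) / N := fun i =>
      div_le_div_of_nonneg_right (by linarith) hN0.le
    rw [MeasureTheory.measureReal_def, Real.volume_Icc_pi_toReal hle]
    simp [← sub_div]
  have hcover : Δ ⊆ ⋃ z ∈ D, cell z := fun x hx => by
    refine Set.mem_iUnion₂.2 ⟨gridCell N x, hD ⟨x, hx, rfl⟩, fun i => ?_, fun i => ?_⟩
    · exact (div_le_iff₀' hN0).2 (Int.floor_le _)
    · exact (le_div_iff₀' hN0).2 (Int.lt_floor_add_one _).le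
  have hfinite : MeasureTheory.volume (⋃ z ∈ D, cell z) ≠ ⊤ :=
    (D.isCompact_biUnion fun _ _ => isCompact_Icc).measure_lt_top.ne
  rw [← le_div_iff₀ (by positivity), div_eq_mul_inv]
  calc MeasureTheory.volume.real Δ ≤ MeasureTheory.volume.real (⋃ z ∈ D, cell z) :=
        MeasureTheory.measureReal_mono hcover hfinite
    _ ≤ ∑ z ∈ D, MeasureTheory.volume.real (cell z) :=
        MeasureTheory.measureReal_biUnion_finset_le D cell
    _ = _ := by simp only [hcell, Finset.sum_const, nsmul_eq_mul]

theorem rpow_volume_mul_pow_le {n k N : ℕ} (hk : 1 ≤ k) (hN : 1 ≤ N) {γ : ℝ} (hγ0 : 0 ≤ γ)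
    (hγ : γ < apExponent k) {a b : Fin n → ℝ} {Δ T : Set (Fin n → ℝ)} (hΔ : Δ ⊆ Set.Icc a b)
    (hvol : 0 < MeasureTheory.volume.real Δ) (hT : ∀ d ∈ Δ, ContainsAP T k d)
    {A : Finset (Fin n → ℤ)} (hA : gridCell N '' T ⊆ A) :
    (MeasureTheory.volume.real Δ * (N : ℝ) ^ n) ^ γ ≤
      (k + 1) ^ 3 * (4 / (apExponent k - γ) + 1) * (A.card * (k + 1) ^ n) := by
  classical
  have hfin : (gridCell N '' Δ).Finite := (Set.finite_Icc (gridCell N a) (gridCell N b)).subset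
    (((gridCell_mono N).mapsTo_Icc.mono_left hΔ).image_subset)
  obtain ⟨D, hD⟩ := hfin.exists_finset_coe
  have hDcard : MeasureTheory.volume.real Δ * (N : ℝ) ^ n ≤ D.card :=
    volume_le_card_mul_of_image_gridCell_subset hN hD.ge
  have hDpos : (0 : ℝ) < D.card := lt_of_lt_of_le (by positivity) hDcard
  set E : Finset (Fin n → ℤ) := Fintype.piFinset fun _ => Finset.Icc (-k : ℤ) 0
  have hE : E.card = (k + 1) ^ n := by
    simp only [E, Fintype.card_piFinset_const, Int.card_Icc]
    congr 1
    omega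
  have hAE : ∀ z ∈ D, ContainsAP ((A + E : Finset (Fin n → ℤ)) : Set (Fin n → ℤ)) k z := by
    intro z hz
    obtain ⟨d, hd, rfl⟩ := hD.le hz
    rw [Finset.coe_add, Fintype.coe_piFinset]
    exact (containsAP_gridCell (hT d hd) N).mono (Set.add_subset_add_right hA)
  have hη : 0 < apExponent k - γ := sub_pos.2 hγ
  calc (MeasureTheory.volume.real Δ * (N : ℝ) ^ n) ^ γ
      ≤ (D.card : ℝ) ^ (apExponent k - (apExponent k - γ)) := by
        rw [sub_sub_cancel]
        gcongr
    _ ≤ (k + 1) ^ 3 * (4 / (apExponent k - γ) + 1) * (A + E).card :=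
        rpow_apExponent_le hk hη (Finset.card_pos.1 (by exact_mod_cast hDpos)) hAE
    _ ≤ _ := by
        gcongr
        exact_mod_cast hE ▸ Finset.card_add_le (s := A) (t := E)

theorem ContainsAP.exists_of_directed {M ι : Type*} [AddCommMonoid M] [Nonempty ι]
    {T : ι → Set M} (hT : Directed (· ⊆ ·) T) {k : ℕ} {d : M}
    (h : ContainsAP (⋃ i, T i) k d) : ∃ i, ContainsAP (T i) k d := by
  classical
  obtain ⟨a, ha⟩ := h
  obtain ⟨i, hi⟩ := hT.exists_mem_subset_of_finset_subset_biUnion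
    (s := (Finset.Icc 1 k).image fun j => a + j • d) fun x hx => by
      obtain ⟨j, hj, rfl⟩ := Finset.mem_image.1 hx
      exact ha j (Finset.mem_Icc.1 hj).1 (Finset.mem_Icc.1 hj).2
  exact ⟨i, a, fun j h1 hjk =>
    hi (Finset.mem_image_of_mem (fun j => a + j • d) (Finset.mem_Icc.2 ⟨h1, hjk⟩))⟩

theorem exists_volume_pos_containsAP_accumulate {n k : ℕ} {B : Set (Fin n → ℝ)}
    (hB : ContainsAllAPs B k) {S : ℕ → Set (Fin n → ℝ)} (hS : B ⊆ ⋃ j, S j) :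
    ∃ J, 0 < MeasureTheory.volume.real
      {d ∈ Set.Icc 0 1 | ContainsAP (Set.accumulate S J) k d} := by
  set Δ : ℕ → Set (Fin n → ℝ) := fun J =>
    {d ∈ Set.Icc 0 1 | ContainsAP (Set.accumulate S J) k d}
  have hcover : Set.Icc 0 1 ⊆ ⋃ J, Δ J := fun d hd => by
    obtain ⟨J, hJ⟩ := ContainsAP.exists_of_directed (Set.monotone_accumulate (s := S)).directed_le
      (((hB d hd).mono hS).mono Set.iUnion_accumulate.ge)
    exact Set.mem_iUnion.2 ⟨J, hd, hJ⟩
  have hcube : MeasureTheory.volume (Set.Icc (0 : Fin n → ℝ) 1) = 1 := by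
    simp [Real.volume_Icc_pi]
  have hunion : MeasureTheory.volume (⋃ J, Δ J) ≠ 0 := fun h => by
    simpa [hcube] using MeasureTheory.measure_mono_null hcover h
  obtain ⟨J, hJ⟩ := MeasureTheory.exists_measure_pos_of_not_measure_iUnion_null hunion
  refine ⟨J, ENNReal.toReal_pos hJ.ne' (ne_top_of_le_ne_top (hcube ▸ ENNReal.one_ne_top) ?_)⟩
  exact MeasureTheory.measure_mono fun d hd => hd.1

theorem le_of_eventually_rpow_le_mul_rpow {a b K : ℝ}
    (h : ∀ᶠ N : ℕ in atTop, (N : ℝ) ^ a ≤ K * (N : ℝ) ^ b) : a ≤ b := by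
  by_contra! hba
  have hlim : Tendsto (fun N : ℕ => (N : ℝ) ^ (a - b)) atTop atTop :=
    (tendsto_rpow_atTop (sub_pos.2 hba)).comp tendsto_natCast_atTop_atTop
  obtain ⟨N, hN, hK, hN1⟩ :=
    (h.and ((hlim.eventually_gt_atTop K).and (eventually_ge_atTop 1))).exists
  have hN0 : (0 : ℝ) < N := by positivity
  rw [Real.rpow_sub hN0, lt_div_iff₀ (by positivity)] at hK
  exact hK.not_ge hN

theorem mul_le_of_lt_apExponent {n k : ℕ} (hk : 1 ≤ k) {B : Set (Fin n → ℝ)}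
    (hB : ContainsAllAPs B k) {S : ℕ → Set (Fin n → ℝ)} (hS : B ⊆ ⋃ j, S j) {s : ℝ}
    (hs : ∀ j, minkowskiDim (S j) < s) {γ : ℝ} (hγ0 : 0 ≤ γ) (hγ : γ < apExponent k) :
    n * γ ≤ s := by
  obtain ⟨J, hJ⟩ := exists_volume_pos_containsAP_accumulate hB hS
  set c := MeasureTheory.volume.real {d ∈ Set.Icc 0 1 | ContainsAP (Set.accumulate S J) k d}
  set K : ℝ := (k + 1) ^ 3 * (4 / (apExponent k - γ) + 1)
  have : 0 ≤ K := by
    have := sub_pos.2 hγ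
    positivity
  refine le_of_eventually_rpow_le_mul_rpow
    (K := K * ((J + 1) * 2 ^ n * (k + 1) ^ n) / c ^ γ) ?_
  filter_upwards [eventually_exists_image_gridCell_accumulate_subset hs J, eventually_ge_atTop 1]
    with N ⟨A, hA_card, hA⟩ hN
  have hN0 : (0 : ℝ) ≤ N := N.cast_nonneg
  have hmain : (c * (N : ℝ) ^ n) ^ γ ≤ K * (A.card * (k + 1) ^ n) :=
    rpow_volume_mul_pow_le hk hN hγ0 hγ (fun d hd => hd.1) hJ (fun d hd => hd.2) hA
  rw [Real.mul_rpow hJ.le (by positivity), ← Real.rpow_natCast, ← Real.rpow_mul hN0] at hmain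
  rw [div_mul_eq_mul_div, le_div_iff₀' (by positivity)]
  calc c ^ γ * (N : ℝ) ^ (n * γ) ≤ K * (A.card * (k + 1) ^ n) := hmain
    _ ≤ K * ((J + 1) * (2 ^ n * (N : ℝ) ^ s) * (k + 1) ^ n) := by gcongr
    _ = _ := by ring

theorem packingAP_nonneg (n k : ℕ) : 0 ≤ packingAP n k :=
  le_iInf₂ fun _ _ => le_iInf₂ fun S _ =>
    (minkowskiDim_nonneg (S 0)).trans (le_iSup (fun j => minkowskiDim (S j)) 0)

theorem mul_le_packingAP (n : ℕ) {k : ℕ} (hk : 1 ≤ k) {γ : ℝ} (hγ0 : 0 ≤ γ)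
    (hγ : γ < apExponent k) : (n * γ : ℝ) ≤ packingAP n k := by
  refine le_iInf₂ fun B hB => le_iInf₂ fun S hS => ?_
  by_contra! hlt
  obtain ⟨s, hSs, hs⟩ := EReal.lt_iff_exists_real_btwn.1 hlt
  have hle : n * γ ≤ s :=
    mul_le_of_lt_apExponent hk hB hS (fun j => (le_iSup _ j).trans_lt hSs) hγ0 hγ
  exact hle.not_gt (EReal.coe_lt_coe_iff.1 hs)

theorem le_packingAP (n : ℕ) {k : ℕ} (hk : 1 ≤ k) :
    (n * apExponent k : ℝ) ≤ packingAP n k := by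
  have hα : 0 ≤ apExponent k := (isSubmultiplicative_minCardAPInitial hk).growthExponent_nonneg
  rcases hα.eq_or_lt with hα0 | hα0
  · rw [← hα0, mul_zero]
    exact packingAP_nonneg n k
  have hlim : Tendsto (fun γ : ℝ => ((n * γ : ℝ) : EReal)) (𝓝[<] apExponent k)
      (𝓝 ((n * apExponent k : ℝ) : EReal)) :=
    EReal.tendsto_coe.2 ((continuous_const_mul (n : ℝ)).tendsto _ |>.mono_left nhdsWithin_le_nhds)
  refine le_of_tendsto hlim ?_
  filter_upwards [Ioo_mem_nhdsLT hα0] with γ hγ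
  exact mul_le_packingAP n hk hγ.1.le hγ.2

theorem packingDim_le_minkowskiDim {n : ℕ} (E : Set (Fin n → ℝ)) :
    packingDim E ≤ minkowskiDim E :=
  (iInf₂_le (fun _ => E) (Set.subset_iUnion (fun _ : ℕ => E) 0)).trans_eq ciSup_const

theorem packingAP_le_minkowskiAP (n k : ℕ) : packingAP n k ≤ minkowskiAP n k :=
  iInf₂_mono fun B _ => packingDim_le_minkowskiDim B

theorem packingAP_eq (n : ℕ) {k : ℕ} (hk : 1 ≤ k) :
    packingAP n k = (n * apExponent k : ℝ) :=
  ((packingAP_le_minkowskiAP n k).trans (minkowskiAP_le n hk)).antisymm (le_packingAP n hk)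

theorem minkowskiAP_eq (n : ℕ) {k : ℕ} (hk : 1 ≤ k) :
    minkowskiAP n k = (n * apExponent k : ℝ) :=
  (minkowskiAP_le n hk).antisymm ((le_packingAP n hk).trans (packingAP_le_minkowskiAP n k))

/-! ### The equivalent conjectures -/

theorem iteratedExponentLimit_iff {F : ℕ → ℕ → ℕ} {g : ℕ → ℝ} {a : ℝ}
    (hg : ∀ k, 1 ≤ k →
      Tendsto (fun N : ℕ => Real.log (F k N) / Real.log N) atTop (𝓝 (g k))) :
    IteratedExponentLimit F a ↔ Tendsto g atTop (𝓝 a) := by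
  refine ⟨?_, fun h => ⟨g, hg, h⟩⟩
  rintro ⟨L, hL, hLa⟩
  refine hLa.congr' ?_
  filter_upwards [eventually_ge_atTop 1] with k hk
  exact tendsto_nhds_unique (hL k hk) (hg k hk)

theorem tendsto_natCast_mul_iff {α : Type*} {l : Filter α} {g : α → ℝ} {n : ℕ} (hn : n ≠ 0) :
    Tendsto (fun x => n * g x) l (𝓝 n) ↔ Tendsto g l (𝓝 1) := by
  have hn' : (n : ℝ) ≠ 0 := by exact_mod_cast hn
  constructor <;> intro h
  · simpa [hn'] using h.const_mul (n : ℝ)⁻¹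
  · simpa using h.const_mul (n : ℝ)

theorem tendsto_ereal_natCast_iff {n : ℕ} (hn : n ≠ 0) {g : ℕ → ℝ} {f : ℕ → EReal}
    (hf : ∀ k, 1 ≤ k → f k = (n * g k : ℝ)) :
    Tendsto f atTop (𝓝 (n : EReal)) ↔ Tendsto g atTop (𝓝 1) := by
  rw [← tendsto_natCast_mul_iff hn, ← EReal.tendsto_coe, EReal.coe_coe_eq_natCast]
  refine tendsto_congr' ?_
  filter_upwards [eventually_ge_atTop 1] with k hk
  exact hf k hk

theorem arithmeticKakeyaInitial_iff : ArithmeticKakeyaInitial ↔ Tendsto apExponent atTop (𝓝 1) :=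
  iteratedExponentLimit_iff fun _ => tendsto_log_minCardAPInitial

theorem arithmeticKakeyaDistinct_iff :
    ArithmeticKakeyaDistinct ↔ Tendsto apExponent atTop (𝓝 1) :=
  iteratedExponentLimit_iff fun _ => tendsto_log_minCardAPDistinct

theorem arithmeticKakeyaDim_iff {n : ℕ} (hn : n ≠ 0) :
    ArithmeticKakeyaDim n ↔ Tendsto apExponent atTop (𝓝 1) :=
  (iteratedExponentLimit_iff fun _ => tendsto_log_minCardAPDim n).trans
    (tendsto_natCast_mul_iff hn)

theorem minkowskiArithmeticKakeya_iff {n : ℕ} (hn : n ≠ 0) :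
    MinkowskiArithmeticKakeya n ↔ Tendsto apExponent atTop (𝓝 1) :=
  tendsto_ereal_natCast_iff hn fun _ => minkowskiAP_eq n

theorem packingArithmeticKakeya_iff {n : ℕ} (hn : n ≠ 0) :
    PackingArithmeticKakeya n ↔ Tendsto apExponent atTop (𝓝 1) :=
  tendsto_ereal_natCast_iff hn fun _ => packingAP_eq n

theorem mainTheorem2 :
    (∀ n k : ℕ, 1 ≤ n → 1 ≤ k → ∃ L : ℝ,
      packingAP n k = (L : EReal) ∧ minkowskiAP n k = (L : EReal) ∧
      Tendsto (fun N : ℕ => Real.log (minCardAPDim n k N) / Real.log N) atTop (𝓝 L)) ∧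
    (∀ k : ℕ, 1 ≤ k → ∃ L : ℝ,
      packingAP 1 k = (L : EReal) ∧ minkowskiAP 1 k = (L : EReal) ∧
      Tendsto (fun N : ℕ => Real.log (minCardAPDistinct k N) / Real.log N) atTop (𝓝 L)) ∧
    (∀ n : ℕ, 1 ≤ n →
      [ArithmeticKakeyaInitial, ArithmeticKakeyaDistinct, ArithmeticKakeyaDim n,
        MinkowskiArithmeticKakeya n, PackingArithmeticKakeya n].TFAE) := by
  refine ⟨fun n k _ hk => ⟨n * apExponent k, packingAP_eq n hk, minkowskiAP_eq n hk,
      tendsto_log_minCardAPDim n hk⟩,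
    fun k hk => ⟨apExponent k, by simpa using packingAP_eq 1 hk, by simpa using minkowskiAP_eq 1 hk,
      tendsto_log_minCardAPDistinct hk⟩, fun n hn => ?_⟩
  have hn0 : n ≠ 0 := Nat.one_le_iff_ne_zero.1 hn
  tfae_have 1 ↔ 2 := arithmeticKakeyaInitial_iff.trans arithmeticKakeyaDistinct_iff.symm
  tfae_have 2 ↔ 3 := arithmeticKakeyaDistinct_iff.trans (arithmeticKakeyaDim_iff hn0).symm
  tfae_have 3 ↔ 4 :=
    (arithmeticKakeyaDim_iff hn0).trans (minkowskiArithmeticKakeya_iff hn0).symm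
  tfae_have 4 ↔ 5 :=
    (minkowskiArithmeticKakeya_iff hn0).trans (packingArithmeticKakeya_iff hn0).symm
  tfae_finish
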